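/- \textbf{Theorem (Differential zeta connection).} Let $p\in\{0,1,2,\dots\}\cup\{\infty\}$ and let $\eta:\mathbb{R}\to\mathbb{R}$ be a compactly supported even function of class $C^p$ with $\eta(0)=1$. (i) Let $z\in\mathbb{C}\setminus\{1\}$ with $|\operatorname{Re} z-1|<p$ (if $p=\infty$, i.e. if $\eta$ is smooth, this is every complex $z\neq 1$). Then $$\lim_{h\to0^+}\left(\sum_{n=1}^\infty -n^{-z}\log n\;\eta(nh)\;-\;\int_0^\infty -x^{-z}\log x\;\eta(xh)\,dx\right)=\zeta'(z).$$ For $\operatorname{Re} z<1$ the integral converges absolutely. For $\operatorname{Re} z\ge 1$ it is understood as a Hadamard finite part, which exists for every $h>0$. Here the finite part of $\int_0^\infty f(x)\,dx$ is the number $L$ such that $\int_\varepsilon^\infty f(x)\,dx-\sum_{i} c_i\,\varepsilon^{\alpha_i}(\log\varepsilon)^{m_i}\to L$ as $\varepsilon\to0^+$ for some finite sum with $c_i,\alpha_i\in\mathbb{C}$, $m_i\in\{0,1,2,\dots\}$, $\operatorname{Re}\alpha_i\le 0$ and $(\alpha_i,m_i)\ne(0,0)$; it is unique, and equals the ordinary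 integral if that converges absolutely. (ii) Let $K\ge0$ be an integer with $p>2K+1$. With the convention $0^0=1$, consider for $h>0$ the linear system for real weights $w_0^h,\dots,w_K^h$ $$\sum_{j=0}^K w_j^h\,j^{2k}\,\eta(jh)=\int_0^\infty -x^{2k}\log x\;\eta(xh)\,dx-\sum_{n=1}^\infty -n^{2k}\log n\;\eta(nh),\qquad k=0,\dots,K.$$ For all sufficiently small $h>0$ it has exactly one solution, the limits $w_j=\lim_{h\to0^+}w_j^h$ $(j=0,\dots,K)$ exist, and $(w_0,\dots,w_K)$ is the unique real solution of the Vandermonde system $$\sum_{j=0}^K w_j\,j^{2k}=-\zeta'(-2k),\qquad k=0,1,\dots,K.$$ -/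

import Mathlib

open Filter Topology MeasureTheory Set

theorem trigSum_coeff_eq_zero (T : Finset ℝ) : ∀ (c : ℝ → ℂ),
    Tendsto (fun t : ℝ => ∑ σ ∈ T, c σ * Complex.exp ((σ * t : ℝ) * Complex.I)) atTop (𝓝 0) →
    ∀ σ ∈ T, c σ = 0 := by
  classical
  induction T using Finset.induction_on with
  | empty => simp
  | insert a T ha ih =>
    intro c hc
    have key : ∀ σ ∈ T, c σ = 0 := by
      intro σ hσ
      have hne : σ - a ≠ 0 := sub_ne_zero.mpr (fun h => ha (h ▸ hσ))
      set s : ℝ := Real.pi / (σ - a) with hs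
      have h1 := hc.comp (tendsto_atTop_add_const_right atTop s tendsto_id)
      have h2 := h1.sub (hc.const_mul (Complex.exp ((a * s : ℝ) * Complex.I)))
      have h3 := ih (fun x => c x * (Complex.exp ((x * s : ℝ) * Complex.I)
        - Complex.exp ((a * s : ℝ) * Complex.I))) (by
          have h4 : (0 : ℂ) - Complex.exp ((a * s : ℝ) * Complex.I) * 0 = 0 := by simp
          rw [h4] at h2
          refine h2.congr (fun t => ?_)
          simp only [Function.comp, id, Finset.sum_insert ha, mul_add, Finset.mul_sum]
          have e : ∀ x : ℝ, Complex.exp ((x * (t + s) : ℝ) * Complex.I)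
              = Complex.exp ((x * s : ℝ) * Complex.I) * Complex.exp ((x * t : ℝ) * Complex.I) := by
            intro x
            rw [← Complex.exp_add]; congr 1; push_cast; ring
          simp only [← mul_add, e]
          rw [add_sub_add_comm, ← Finset.sum_sub_distrib]
          rw [show ∀ u v w : ℂ, u * (v * w) - v * (u * w) = 0 by intros; ring, zero_add]
          exact Finset.sum_congr rfl (fun x _ => by ring)) σ hσ
      refine (mul_eq_zero.mp h3).resolve_right (fun h5 => ?_)
      have h6 : Complex.exp ((σ * s : ℝ) * Complex.I)
          = -Complex.exp ((a * s : ℝ) * Complex.I) := by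
        have : ((σ * s : ℝ) : ℂ) * Complex.I = (a * s : ℝ) * Complex.I + Real.pi * Complex.I := by
          have : σ * s = a * s + Real.pi := by rw [hs]; field_simp; ring
          rw [this]; push_cast; ring
        rw [this, Complex.exp_add, Complex.exp_pi_mul_I]; ring
      rw [h6] at h5
      exact Complex.exp_ne_zero ((a * s : ℝ) * Complex.I) (by linear_combination (-1 / 2) * h5)
    intro σ hσ
    rcases Finset.mem_insert.mp hσ with rfl | h
    · have h1 : Tendsto (fun t : ℝ => c σ * Complex.exp ((σ * t : ℝ) * Complex.I)) atTop (𝓝 0) := by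
        refine hc.congr (fun t => ?_)
        rw [Finset.sum_insert ha, Finset.sum_eq_zero (fun x hx => by rw [key x hx, zero_mul]),
          add_zero]
      have h2 := h1.norm
      simp only [norm_mul, Complex.norm_exp_ofReal_mul_I, mul_one, norm_zero] at h2
      exact norm_eq_zero.mp (tendsto_nhds_unique tendsto_const_nhds h2)
    · exact key σ h

theorem expPoly_coeff_eq_zero (S : Finset (ℂ × ℕ)) (c : ℂ × ℕ → ℂ)
    (hre : ∀ q ∈ S, 0 ≤ q.1.re)
    (hc : Tendsto (fun t : ℝ => ∑ q ∈ S, c q * (Complex.exp (q.1 * t) * (t : ℂ) ^ q.2))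
      atTop (𝓝 0)) :
    ∀ q ∈ S, c q = 0 := by
  classical
  by_contra! hcon
  set S' := S.filter (fun q => c q ≠ 0) with hS'
  have hne : S'.Nonempty := by
    obtain ⟨q, hq, hq'⟩ := hcon
    exact ⟨q, by simp [hS', hq, hq']⟩
  obtain ⟨⟨b, M⟩, hbM, hmax⟩ := Finset.exists_max_image S' (fun q => toLex (q.1.re, q.2)) hne
  have hc' : Tendsto (fun t : ℝ => ∑ q ∈ S', c q * (Complex.exp (q.1 * t) * (t : ℂ) ^ q.2))
      atTop (𝓝 0) := by
    refine hc.congr (fun t => ?_)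
    rw [hS', Finset.sum_filter]
    exact Finset.sum_congr rfl (fun q _ => by by_cases h : c q = 0 <;> simp [h])
  have hb0 : 0 ≤ b.re := hre _ (Finset.mem_of_mem_filter _ hbM)
  let g : ℝ → ℂ := fun t => Complex.exp (-(b.re * t : ℝ)) * ((t : ℂ) ^ M)⁻¹
  have hg : ∀ᶠ t in atTop, ‖g t‖ ≤ 1 := by
    filter_upwards [eventually_ge_atTop 1] with t ht
    have h1 : ‖Complex.exp (-((b.re * t : ℝ) : ℂ))‖ ≤ 1 := by
      rw [Complex.norm_exp]
      simp only [Complex.neg_re, Complex.ofReal_re]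
      exact Real.exp_le_one_iff.mpr (by nlinarith)
    have h2 : ‖((t : ℂ) ^ M)⁻¹‖ ≤ 1 := by
      rw [norm_inv, norm_pow, Complex.norm_real, Real.norm_of_nonneg (by linarith)]
      exact inv_le_one_of_one_le₀ (one_le_pow₀ ht)
    simp only [g, norm_mul]
    exact mul_le_one₀ h1 (norm_nonneg _) h2
  have hprod : Tendsto (fun t : ℝ => (∑ q ∈ S', c q * (Complex.exp (q.1 * t) * (t : ℂ) ^ q.2)) * g t)
      atTop (𝓝 0) := by
    refine squeeze_zero_norm' ?_ (by simpa using hc'.norm)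
    filter_upwards [hg] with t ht
    rw [norm_mul]
    exact mul_le_of_le_one_right (norm_nonneg _) ht
  let top : ℂ × ℕ → Prop := fun q => q.1.re = b.re ∧ q.2 = M
  have hlow : Tendsto (fun t : ℝ => ∑ q ∈ S'.filter (fun q => ¬ top q),
      c q * (Complex.exp (q.1 * t) * (t : ℂ) ^ q.2) * g t) atTop (𝓝 0) := by
    rw [show (0 : ℂ) = ∑ q ∈ S'.filter (fun q => ¬ top q), (0 : ℂ) by simp]
    refine tendsto_finsetSum _ (fun q hq => ?_)
    obtain ⟨hq1, hq2⟩ := Finset.mem_filter.mp hq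
    have hle := hmax q hq1
    rw [Prod.Lex.toLex_le_toLex] at hle
    rw [show (0 : ℂ) = c q * 0 by simp]
    simp only [mul_assoc]
    refine Tendsto.const_mul _ ?_
    have hnorm : ∀ t : ℝ, 1 ≤ t → ‖Complex.exp (q.1 * t) * ((t : ℂ) ^ q.2 * g t)‖
        = t ^ q.2 * Real.exp (-(b.re - q.1.re) * t) * (t ^ M)⁻¹ := by
      intro t ht
      have ht0 : ‖(t : ℂ)‖ = t := by rw [Complex.norm_real, Real.norm_of_nonneg (by linarith)]
      simp only [g, norm_mul, norm_inv, norm_pow, ht0, Complex.norm_exp]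
      have : Real.exp (-(b.re - q.1.re) * t) = Real.exp (q.1.re * t) * Real.exp (-(b.re * t)) := by
        rw [← Real.exp_add]; congr 1; ring
      rw [this]
      simp only [Complex.neg_re, Complex.ofReal_re, Complex.mul_re, Complex.ofReal_im, mul_zero,
        sub_zero]
      ring
    rw [tendsto_zero_iff_norm_tendsto_zero]
    have hev : (fun t : ℝ => t ^ q.2 * Real.exp (-(b.re - q.1.re) * t) * (t ^ M)⁻¹) =ᶠ[atTop]
        fun t : ℝ => ‖Complex.exp (q.1 * t) * ((t : ℂ) ^ q.2 * g t)‖ := by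
      filter_upwards [eventually_ge_atTop 1] with t ht using (hnorm t ht).symm
    refine Tendsto.congr' hev ?_
    rcases hle with hlt | ⟨heq, hle2⟩
    · have h1 : Tendsto (fun t : ℝ => t ^ q.2 * Real.exp (-(b.re - q.1.re) * t)) atTop (𝓝 0) := by
        have := tendsto_rpow_mul_exp_neg_mul_atTop_nhds_zero (q.2 : ℝ) (b.re - q.1.re)
          (sub_pos.mpr hlt)
        simpa only [Real.rpow_natCast] using this
      refine squeeze_zero' ?_ ?_ h1
      · filter_upwards [eventually_ge_atTop 1] with t ht
        have : 0 ≤ t := by linarith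
        positivity
      · filter_upwards [eventually_ge_atTop 1] with t ht
        have : 0 ≤ t := by linarith
        exact mul_le_of_le_one_right (by positivity) (inv_le_one_of_one_le₀ (one_le_pow₀ ht))
    · have hlt2 : q.2 < M := lt_of_le_of_ne hle2 (fun h => hq2 ⟨heq, h⟩)
      have h1 := tendsto_pow_div_pow_atTop_zero (𝕜 := ℝ) hlt2
      refine h1.congr (fun t => ?_)
      have : q.1.re = b.re := heq
      rw [this, sub_self, neg_zero, zero_mul, Real.exp_zero, mul_one, div_eq_mul_inv]
  have htop := hprod.sub hlow
  rw [sub_zero] at htop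
  have htrig : Tendsto (fun t : ℝ => ∑ σ ∈ (S'.filter top).image (fun q => q.1.im),
      c (⟨b.re, σ⟩, M) * Complex.exp ((σ * t : ℝ) * Complex.I)) atTop (𝓝 0) := by
    refine htop.congr' ?_
    filter_upwards [eventually_gt_atTop 0] with t ht
    rw [Finset.sum_mul, ← Finset.sum_filter_add_sum_filter_not S' top, add_sub_cancel_right,
      Finset.sum_image]
    · refine Finset.sum_congr rfl (fun q hq => ?_)
      obtain ⟨-, h1, h2⟩ := Finset.mem_filter.mp hq
      have hq' : ((⟨b.re, q.1.im⟩, M) : ℂ × ℕ) = q := by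
        rw [← h1, ← h2]
      rw [hq', h2]
      have ht' : (t : ℂ) ^ M ≠ 0 := pow_ne_zero _ (by exact_mod_cast ht.ne')
      simp only [g]
      have : Complex.exp ((q.1.im * t : ℝ) * Complex.I)
          = Complex.exp (q.1 * t) * Complex.exp (-(b.re * t : ℝ)) := by
        rw [← Complex.exp_add]
        congr 1
        nth_rewrite 2 [← Complex.re_add_im q.1]
        rw [h1]; push_cast; ring
      rw [this]
      field_simp
    · intro q hq q' hq' h
      obtain ⟨-, h1, h2⟩ := Finset.mem_filter.mp (Finset.mem_coe.mp hq)
      obtain ⟨-, h1', h2'⟩ := Finset.mem_filter.mp (Finset.mem_coe.mp hq')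
      exact Prod.ext (Complex.ext (h1.trans h1'.symm) h) (h2.trans h2'.symm)
  have := trigSum_coeff_eq_zero _ (fun σ => c (⟨b.re, σ⟩, M)) htrig b.im
    (Finset.mem_image.mpr ⟨(b, M), Finset.mem_filter.mpr ⟨hbM, rfl, rfl⟩, rfl⟩)
  exact (Finset.mem_filter.mp hbM).2 this

/-- `L` is the Hadamard finite part at `0` of the integral of `f` over `(0, ∞)`: the integrals over
`(ε, ∞)` converge to `L` as `ε → 0⁺` after subtraction of finitely many terms
`c ε ^ α (log ε) ^ m` with `Re α ≤ 0` and `(α, m) ≠ (0, 0)`. -/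
def HasFinitePart (f : ℝ → ℂ) (L : ℂ) : Prop :=
  (∀ ε : ℝ, 0 < ε → IntegrableOn f (Ioi ε)) ∧
  ∃ (S : Finset (ℂ × ℕ)) (c : ℂ × ℕ → ℂ), (∀ q ∈ S, q.1.re ≤ 0 ∧ q ≠ (0, 0)) ∧
    Tendsto (fun ε : ℝ => (∫ x in Ioi ε, f x)
      - ∑ q ∈ S, c q * ((ε : ℂ) ^ q.1 * (Real.log ε : ℂ) ^ q.2)) (𝓝[>] 0) (𝓝 L)

theorem HasFinitePart.unique {f : ℝ → ℂ} {L L' : ℂ} (h : HasFinitePart f L)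
    (h' : HasFinitePart f L') : L = L' := by
  classical
  obtain ⟨-, S, c, hS, hc⟩ := h
  obtain ⟨-, S', c', hS', hc'⟩ := h'
  have hexp : Tendsto (fun t : ℝ => Real.exp (-t)) atTop (𝓝[>] 0) :=
    tendsto_nhdsWithin_iff.mpr ⟨Real.tendsto_exp_neg_atTop_nhds_zero,
      Eventually.of_forall (fun t => Real.exp_pos _)⟩
  have hd := ((hc'.sub hc).sub_const (L' - L)).comp hexp
  rw [sub_self] at hd
  let d : ℂ × ℕ → ℂ := fun q => (if q ∈ S then c q else 0) - (if q ∈ S' then c' q else 0)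
  let T : Finset (ℂ × ℕ) := S ∪ S'
  have hT0 : ∀ q ∈ T, q.1.re ≤ 0 ∧ q ≠ (0, 0) := by
    intro q hq
    rcases Finset.mem_union.mp hq with h | h
    · exact hS q h
    · exact hS' q h
  have h0T : ((0, 0) : ℂ × ℕ) ∉ T := fun h => (hT0 _ h).2 rfl
  let neg : ℂ × ℕ → ℂ × ℕ := fun q => (-q.1, q.2)
  have hneg : ∀ q, neg (neg q) = q := fun q => by simp [neg]
  have hninj : Function.Injective neg := Function.LeftInverse.injective hneg
  let e : ℂ × ℕ → ℂ := fun q =>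
    if q = (0, 0) then L - L' else d (neg q) * (-1) ^ q.2
  have hmem0 : ((0, 0) : ℂ × ℕ) ∉ T.image neg := by
    intro h
    obtain ⟨q, hq, hq'⟩ := Finset.mem_image.mp h
    apply h0T
    have : q = (0, 0) := by rw [← hneg q, hq']; simp [neg]
    rwa [← this]
  have := expPoly_coeff_eq_zero (insert (0, 0) (T.image neg)) e ?_ ?_ (0, 0)
    (Finset.mem_insert_self _ _)
  · simpa [e, sub_eq_zero] using this
  · intro q hq
    rcases Finset.mem_insert.mp hq with rfl | h
    · simp
    · obtain ⟨r, hr, rfl⟩ := Finset.mem_image.mp h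
      simpa [neg] using (hT0 r hr).1
  · refine hd.congr (fun t => ?_)
    rw [Finset.sum_insert hmem0, Finset.sum_image (fun _ _ _ _ h => hninj h)]
    have hterm : ∀ q : ℂ × ℕ, ((Real.exp (-t) : ℝ) : ℂ) ^ q.1 * (Real.log (Real.exp (-t)) : ℂ) ^ q.2
        = (-1) ^ q.2 * (Complex.exp ((neg q).1 * t) * (t : ℂ) ^ (neg q).2) := by
      intro q
      rw [Real.log_exp, Complex.cpow_def_of_ne_zero (by exact_mod_cast (Real.exp_pos _).ne'),
        ← Complex.ofReal_log (Real.exp_pos _).le, Real.log_exp]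
      simp only [neg]
      rw [Complex.ofReal_neg, neg_pow (t : ℂ),
        show -(t : ℂ) * q.1 = -q.1 * t by ring]
      ring
    have hsumS : ∀ (U : Finset (ℂ × ℕ)) (a F : ℂ × ℕ → ℂ), U ⊆ T →
        ∑ q ∈ U, a q * F q = ∑ q ∈ T, (if q ∈ U then a q else 0) * F q := by
      intro U a F hU
      rw [← Finset.sum_subset hU (f := fun q => (if q ∈ U then a q else 0) * F q)]
      · exact Finset.sum_congr rfl (fun q hq => by simp [hq])
      · intro q _ hq; simp [hq]
    have hE : ∀ q ∈ T, e (neg q) * (Complex.exp ((neg q).1 * t) * (t : ℂ) ^ (neg q).2)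
        = d q * (((Real.exp (-t) : ℝ) : ℂ) ^ q.1 * (Real.log (Real.exp (-t)) : ℂ) ^ q.2) := by
      intro q hq
      have : neg q ≠ (0, 0) := fun h => hmem0 (h ▸ Finset.mem_image_of_mem neg hq)
      rw [hterm]
      simp only [e, if_neg this, hneg]
      simp only [neg]
      ring
    rw [Finset.sum_congr rfl hE]
    simp only [Function.comp]
    rw [hsumS S c _ Finset.subset_union_left, hsumS S' c' _ Finset.subset_union_right]
    simp only [d, sub_mul, Finset.sum_sub_distrib]
    simp [e]
    ring

open Classical in
/-- The Hadamard finite part of the integral of `f` over `(0, ∞)` (by convention `0` if there is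
none). -/
noncomputable def finitePart (f : ℝ → ℂ) : ℂ :=
  if h : ∃ L, HasFinitePart f L then h.choose else 0

theorem HasFinitePart.finitePart_eq {f : ℝ → ℂ} {L : ℂ} (h : HasFinitePart f L) :
    finitePart f = L := by
  have h' : ∃ L, HasFinitePart f L := ⟨L, h⟩
  rw [finitePart, dif_pos h']
  exact h'.choose_spec.unique h

/-- The finite part is the ordinary integral whenever the latter converges absolutely. -/
theorem hasFinitePart_of_integrableOn {f : ℝ → ℂ} (hf : IntegrableOn f (Ioi 0)) :
    HasFinitePart f (∫ x in Ioi 0, f x) := by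
  refine ⟨fun ε hε => hf.mono_set (Ioi_subset_Ioi hε.le), ∅, 0, by simp, ?_⟩
  simp only [Finset.sum_empty, sub_zero]
  have h1 : Tendsto (fun ε : ℝ => ∫ x, (Ioi ε).indicator f x ∂(volume.restrict (Ioi 0)))
      (𝓝[>] 0) (𝓝 (∫ x in Ioi 0, f x)) := by
    refine tendsto_integral_filter_of_dominated_convergence (fun x => ‖f x‖) ?_ ?_ hf.norm ?_
    · exact Eventually.of_forall (fun ε => hf.aestronglyMeasurable.indicator measurableSet_Ioi)
    · exact Eventually.of_forall (fun ε => Eventually.of_forall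
        (fun x => norm_indicator_le_norm_self _ _))
    · filter_upwards [ae_restrict_mem measurableSet_Ioi] with x hx
      refine tendsto_const_nhds.congr' ?_
      filter_upwards [nhdsWithin_le_nhds (Iio_mem_nhds (mem_Ioi.mp hx))] with ε hε
      rw [indicator_of_mem (mem_Ioi.mpr hε)]
  refine h1.congr' ?_
  filter_upwards [self_mem_nhdsWithin] with ε hε
  rw [integral_indicator measurableSet_Ioi, Measure.restrict_restrict measurableSet_Ioi,
    inter_eq_left.mpr (Ioi_subset_Ioi (le_of_lt hε))]

/-- A cutoff function of class `C^p`: `p` times continuously differentiable on the real line,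
compactly supported, even, with value `1` at the origin. -/
structure IsCutoff (p : ℕ∞) (η : ℝ → ℝ) : Prop where
  contDiff : ContDiff ℝ p η
  hasCompactSupport : HasCompactSupport η
  even : ∀ x, η (-x) = η x
  map_zero : η 0 = 1

/-- The function `x ↦ -x ^ (-z) log x · η (x h)`, for `x > 0`. -/
noncomputable def logIntegrand (η : ℝ → ℝ) (z : ℂ) (h x : ℝ) : ℂ :=
  -((x : ℂ) ^ (-z) * (Real.log x : ℂ)) * (η (x * h) : ℂ)

/-- The sum over `n ≥ 1` of `-n ^ (-z) log n · η (n h)`; for compactly supported `η` and `h > 0`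
only finitely many terms are nonzero. -/
noncomputable def logSum (η : ℝ → ℝ) (z : ℂ) (h : ℝ) : ℂ :=
  ∑' n : ℕ, logIntegrand η z h ((n : ℝ) + 1)

/-- The moment-fitting equations with parameter `h` for the logarithmic singularity, with unknown
weights `w 0, …, w K`. -/
def SolvesLogMomentSystem (η : ℝ → ℝ) (K : ℕ) (h : ℝ) (w : Fin (K + 1) → ℝ) : Prop :=
  ∀ k : Fin (K + 1),
    ∑ j : Fin (K + 1), w j * (j : ℝ) ^ (2 * (k : ℕ)) * η ((j : ℝ) * h) =
      (∫ x in Ioi (0 : ℝ), -(x ^ (2 * (k : ℕ)) * Real.log x) * η (x * h)) -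
        ∑' n : ℕ, -(((n : ℝ) + 1) ^ (2 * (k : ℕ)) * Real.log ((n : ℝ) + 1)) * η (((n : ℝ) + 1) * h)

/-- The Vandermonde system `∑ j, w j * j ^ (2 k) = -ζ'(-2 k)`, `k = 0, …, K`. -/
def SolvesZetaPrimeSystem (K : ℕ) (w : Fin (K + 1) → ℝ) : Prop :=
  ∀ k : Fin (K + 1),
    ∑ j : Fin (K + 1), (w j : ℂ) * (j : ℂ) ^ (2 * (k : ℕ)) =
      -deriv riemannZeta (-2 * (k : ℂ))

/-! Since the derivative of `x ^ (-z) η(xh)` is `x ^ (-z - 1) ((Eη)(xh) - z η(xh))` with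
`(Eη)(y) = y η'(y)`, the functions `x ^ (-z) η(xh)` are stable under differentiation in `x`, with
constants that do not depend on `h`. Euler–Maclaurin summation against the periodized Bernoulli
functions therefore gains one unit of decay per derivative of `η`, and
`∑ n ^ (-z) η(nh) - ∫_1^∞ x ^ (-z) η(xh) dx` converges locally uniformly on `Re z > 1 - m` as soon
as `η` is of class `C^m` with `m ≥ 1`. The limit is holomorphic and equals `ζ(z) - 1 / (z - 1)` for
`Re z > 1`, hence everywhere by the identity theorem. Locally uniform limits may be differentiated
in `z`, which brings in the logarithm and gives `ζ'(z) + 1 / (z - 1) ^ 2`. Over `(0, 1]`, the Taylor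
expansion of `η` at `0` shows that the finite part exists; as `h → 0` only the constant term
survives, and it contributes `1 / (z - 1) ^ 2`, which cancels.

At `z = -2k` this is the limit of the right-hand sides of the moment-fitting equations, whose
matrix tends to an invertible Vandermonde matrix as `h → 0`; matrix inversion is continuous there.
-/

theorem periodizedBernoulli_coe (k : ℕ) (x : ℝ) :
    periodizedBernoulli k (x : UnitAddCircle) = bernoulliFun k (Int.fract x) := by
  simp only [periodizedBernoulli, AddCircle.liftIco, Function.comp_apply, domRestrict_apply,
    AddCircle.coe_equivIco_mk_apply, div_one, mul_one]

theorem periodizedBernoulli_coe_of_mem_Ico (k : ℕ) {n : ℤ} {x : ℝ}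
    (hx : x ∈ Ico (n : ℝ) (n + 1)) :
    periodizedBernoulli k (x : UnitAddCircle) = bernoulliFun k (x - n) := by
  rw [periodizedBernoulli_coe, Int.fract, Int.floor_eq_on_Ico n x hx]

theorem measurable_periodizedBernoulli_coe (k : ℕ) :
    Measurable fun x : ℝ => periodizedBernoulli k (x : UnitAddCircle) := by
  simp only [periodizedBernoulli_coe]
  exact (continuous_bernoulliFun k).measurable.comp measurable_fract

theorem exists_abs_periodizedBernoulli_coe_le (k : ℕ) :
    ∃ C, ∀ x : ℝ, |periodizedBernoulli k (x : UnitAddCircle)| ≤ C := by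
  obtain ⟨C, hC⟩ := (isCompact_Icc (a := (0 : ℝ)) (b := 1)).exists_bound_of_continuousOn
    (continuous_bernoulliFun k).continuousOn
  refine ⟨C, fun x => ?_⟩
  rw [periodizedBernoulli_coe]
  exact hC _ ⟨Int.fract_nonneg x, (Int.fract_lt_one x).le⟩

theorem integrableOn_periodizedBernoulli_mul (k : ℕ) {u : ℝ → ℂ} {s : Set ℝ}
    (hu : IntegrableOn u s) :
    IntegrableOn (fun x : ℝ => (periodizedBernoulli k x : ℂ) * u x) s := by
  obtain ⟨C, hC⟩ := exists_abs_periodizedBernoulli_coe_le k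
  refine hu.bdd_mul (c := C) ?_ (ae_of_all _ fun x => by simpa using hC x)
  exact (Complex.measurable_ofReal.comp
    (measurable_periodizedBernoulli_coe k)).aestronglyMeasurable

section EulerMaclaurin

variable {u u' : ℝ → ℂ}

theorem integral_periodizedBernoulli_mul_unit (k n : ℕ)
    (hu : ∀ x ∈ Icc (n : ℝ) (n + 1), HasDerivAt u (u' x) x)
    (hu' : ContinuousOn u' (Icc (n : ℝ) (n + 1))) :
    ∫ x in (n : ℝ)..(n + 1), (periodizedBernoulli k x : ℂ) * u x =
      ((bernoulliFun (k + 1) 1 : ℂ) * u (n + 1) - (bernoulliFun (k + 1) 0 : ℂ) * u n) / (k + 1)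
        - 1 / (k + 1) * ∫ x in (n : ℝ)..(n + 1), (periodizedBernoulli (k + 1) x : ℂ) * u' x := by
  have hle : (n : ℝ) ≤ n + 1 := by linarith
  have polynomial_on_unit (j : ℕ) (v : ℝ → ℂ) :
      ∫ x in (n : ℝ)..(n + 1), (periodizedBernoulli j x : ℂ) * v x =
        ∫ x in (n : ℝ)..(n + 1), (bernoulliFun j (x - n) : ℂ) * v x := by
    refine intervalIntegral.integral_congr_Ioo_of_le hle fun x hx => ?_
    simp [periodizedBernoulli_coe_of_mem_Ico j (n := n) (x := x) ⟨hx.1.le, hx.2⟩]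
  have hB (x : ℝ) : HasDerivAt (fun x : ℝ => (bernoulliFun (k + 1) (x - n) : ℂ) / (k + 1))
      (bernoulliFun k (x - n) : ℂ) x := by
    simpa [Function.comp_def] using ((antideriv_bernoulliFun k (x - n)).comp x
      ((hasDerivAt_id x).sub_const (n : ℝ))).ofReal_comp
  have hcB : Continuous fun x : ℝ => (bernoulliFun k (x - n) : ℂ) := by fun_prop
  rw [← uIcc_of_le hle] at hu hu'
  have by_parts := intervalIntegral.integral_deriv_mul_eq_sub (fun x _ => hB x) hu
    (hcB.intervalIntegrable _ _) hu'.intervalIntegrable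
  rw [polynomial_on_unit, polynomial_on_unit, ← intervalIntegral.integral_const_mul,
    eq_sub_iff_add_eq, ← intervalIntegral.integral_add]
  · convert by_parts using 1
    · refine intervalIntegral.integral_congr fun x _ => ?_
      ring
    · rw [add_sub_cancel_left, sub_self]
      ring
  · exact (hcB.continuousOn.mul
      fun x hx => (hu x hx).continuousAt.continuousWithinAt).intervalIntegrable
  · have : Continuous fun x : ℝ => (bernoulliFun (k + 1) (x - n) : ℂ) := by fun_prop
    exact ((this.continuousOn.mul hu').intervalIntegrable).const_mul _

theorem sum_Ico_integral_periodizedBernoulli_mul (k : ℕ) {m n : ℕ} (hmn : m ≤ n)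
    {v : ℝ → ℂ} (hv : ContinuousOn v (Ici (m : ℝ))) :
    ∑ i ∈ Finset.Ico m n, ∫ x in (i : ℝ)..(i + 1), (periodizedBernoulli k x : ℂ) * v x =
      ∫ x in (m : ℝ)..n, (periodizedBernoulli k x : ℂ) * v x := by
  rw [← intervalIntegral.sum_integral_adjacent_intervals_Ico (a := fun i : ℕ => (i : ℝ)) hmn]
  · push_cast; rfl
  · intro i hi
    rw [intervalIntegrable_iff_integrableOn_Icc_of_le (by simp)]
    refine integrableOn_periodizedBernoulli_mul k (ContinuousOn.integrableOn_compact
      isCompact_Icc (hv.mono fun x hx => ?_))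
    exact (Nat.cast_le.mpr hi.1).trans hx.1

theorem integral_periodizedBernoulli_mul (k : ℕ) {m n : ℕ} (hmn : m ≤ n)
    (hu : ∀ x, (m : ℝ) ≤ x → HasDerivAt u (u' x) x) (hu' : ContinuousOn u' (Ici (m : ℝ))) :
    ∫ x in (m : ℝ)..n, (periodizedBernoulli k x : ℂ) * u x =
      (∑ i ∈ Finset.Ico m n, ((bernoulliFun (k + 1) 1 : ℂ) * u (i + 1 : ℕ)
        - (bernoulliFun (k + 1) 0 : ℂ) * u i)) / (k + 1)
      - 1 / (k + 1) * ∫ x in (m : ℝ)..n, (periodizedBernoulli (k + 1) x : ℂ) * u' x := by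
  rw [← sum_Ico_integral_periodizedBernoulli_mul k hmn
      fun x hx => (hu x hx).continuousAt.continuousWithinAt,
    ← sum_Ico_integral_periodizedBernoulli_mul (k + 1) hmn hu', Finset.mul_sum, Finset.sum_div,
    ← Finset.sum_sub_distrib]
  refine Finset.sum_congr rfl fun i hi => ?_
  have hmi : (m : ℝ) ≤ i := Nat.cast_le.mpr (Finset.mem_Ico.mp hi).1
  rw [Nat.cast_succ]
  exact integral_periodizedBernoulli_mul_unit k i (fun x hx => hu x (hmi.trans hx.1))
    (hu'.mono fun x hx => hmi.trans hx.1)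

theorem integral_periodizedBernoulli_mul_Ioi {k : ℕ} (hk : k ≠ 0) (m : ℕ)
    (hu : ∀ x, (m : ℝ) ≤ x → HasDerivAt u (u' x) x) (hu' : ContinuousOn u' (Ici (m : ℝ)))
    (hui : IntegrableOn u (Ioi (m : ℝ))) (hui' : IntegrableOn u' (Ioi (m : ℝ)))
    (hlim : Tendsto u atTop (𝓝 0)) :
    ∫ x in Ioi (m : ℝ), (periodizedBernoulli k x : ℂ) * u x =
      (bernoulliFun (k + 1) 0 : ℂ) / (k + 1) * (0 - u m)
      - 1 / (k + 1) * ∫ x in Ioi (m : ℝ), (periodizedBernoulli (k + 1) x : ℂ) * u' x := by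
  have finite_step : ∀ᶠ n : ℕ in atTop,
      (bernoulliFun (k + 1) 0 : ℂ) / (k + 1) * (u n - u m) -
          1 / (k + 1) * ∫ x in (m : ℝ)..n, (periodizedBernoulli (k + 1) x : ℂ) * u' x =
        ∫ x in (m : ℝ)..n, (periodizedBernoulli k x : ℂ) * u x := by
    filter_upwards [eventually_ge_atTop m] with n hmn
    rw [integral_periodizedBernoulli_mul k hmn hu hu',
      bernoulliFun_endpoints_eq_of_ne_one (by simpa using hk)]
    simp only [← mul_sub]
    rw [← Finset.mul_sum, Finset.sum_Ico_sub (fun i : ℕ => u i) hmn]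
    ring
  have hcast := tendsto_natCast_atTop_atTop (R := ℝ)
  refine tendsto_nhds_unique (intervalIntegral_tendsto_integral_Ioi _
    (integrableOn_periodizedBernoulli_mul k hui) hcast) (Tendsto.congr' finite_step ?_)
  exact (((hlim.comp hcast).sub_const (u m)).const_mul _).sub
    ((intervalIntegral_tendsto_integral_Ioi _
      (integrableOn_periodizedBernoulli_mul (k + 1) hui') hcast).const_mul _)

theorem tsum_sub_integral_Ioi_one (hu : ∀ x, 1 ≤ x → HasDerivAt u (u' x) x)
    (hu' : ContinuousOn u' (Ici 1)) (hs : Summable fun n : ℕ => u (n + 1))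
    (hui : IntegrableOn u (Ioi 1)) (hui' : IntegrableOn u' (Ioi 1))
    (hlim : Tendsto u atTop (𝓝 0)) :
    ∑' n : ℕ, u (n + 1) - ∫ x in Ioi 1, u x =
      (0 + u 1) / 2 + ∫ x in Ioi (1 : ℝ), (periodizedBernoulli 1 x : ℂ) * u' x := by
  have finite_step : ∀ᶠ n : ℕ in atTop,
      (u n + u 1) / 2 + ∫ x in (1 : ℝ)..n, (periodizedBernoulli 1 x : ℂ) * u' x =
        ∑ i ∈ Finset.range n, u (i + 1) - ∫ x in (1 : ℝ)..n, u x := by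
    filter_upwards [eventually_ge_atTop 1] with n hn
    have h := integral_periodizedBernoulli_mul 0 hn (by simpa using hu) (by simpa using hu')
    have telescope := Finset.sum_Ico_sub (fun i : ℕ => u i) hn
    simp only [periodizedBernoulli_coe, bernoulliFun_zero, Complex.ofReal_one, one_mul,
      zero_add, bernoulliFun_one, Nat.cast_zero, div_one, Nat.cast_one, Finset.sum_sub_distrib,
      ← Finset.mul_sum] at h telescope ⊢
    rw [Finset.range_eq_Ico, Finset.sum_eq_sum_Ico_succ_bot hn, h]
    push_cast at telescope ⊢
    rw [zero_add]
    linear_combination (-1 / 2 : ℂ) * telescope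
  have hcast := tendsto_natCast_atTop_atTop (R := ℝ)
  refine tendsto_nhds_unique (hs.tendsto_sum_tsum_nat.sub
    (intervalIntegral_tendsto_integral_Ioi _ hui hcast)) (Tendsto.congr' finite_step ?_)
  exact (((hlim.comp hcast).add_const (u 1)).div_const 2).add
    (intervalIntegral_tendsto_integral_Ioi _ (integrableOn_periodizedBernoulli_mul 1 hui') hcast)

end EulerMaclaurin

/-- The function `x ↦ x ^ (-z) φ (x h)`: a power, cut off at scale `1 / h` by `φ`. -/
noncomputable def cutPow (φ : ℝ → ℝ) (h : ℝ) (z : ℂ) (x : ℝ) : ℂ :=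
  (x : ℂ) ^ (-z) * (φ (x * h) : ℂ)

/-- The Euler operator `φ ↦ y φ'(y)`. Since `x` times the derivative of `x ↦ φ (x h)` is
`(eulerOp φ) (x h)`, it keeps the functions `cutPow φ h z` stable under differentiation in `x`. -/
noncomputable def eulerOp (φ : ℝ → ℝ) (y : ℝ) : ℝ := y * deriv φ y

/-- The error term of Euler–Maclaurin summation of `cutPow φ h z` over `[1, ∞)`, before the
integrand is differentiated. -/
noncomputable def bernoulliIntegral (k : ℕ) (φ : ℝ → ℝ) (h : ℝ) (z : ℂ) : ℂ :=
  ∫ x in Ioi (1 : ℝ), (periodizedBernoulli k x : ℂ) * cutPow φ h z x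

/-- The sum of `n ^ (-z) φ (n h)` over `n ≥ 1`, minus the corresponding integral over `(1, ∞)`. -/
noncomputable def sumSubIntegral (φ : ℝ → ℝ) (h : ℝ) (z : ℂ) : ℂ :=
  ∑' n : ℕ, cutPow φ h z (n + 1) - ∫ x in Ioi (1 : ℝ), cutPow φ h z x

section CutPow

variable {φ : ℝ → ℝ} {h a : ℝ}

theorem hasCompactSupport_eulerOp (hs : HasCompactSupport φ) : HasCompactSupport (eulerOp φ) :=
  hs.deriv.mul_left (f := fun y : ℝ => y)

theorem contDiff_eulerOp {m : ℕ} (hφ : ContDiff ℝ (m + 1 : ℕ) φ) : ContDiff ℝ m (eulerOp φ) :=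
  contDiff_id.mul (ContDiff.deriv' (by exact_mod_cast hφ))

theorem continuous_eulerOp (hφ : ContDiff ℝ 1 φ) : Continuous (eulerOp φ) :=
  continuous_id.mul hφ.continuous_deriv_one

theorem eventually_comp_mul_eq_zero (hs : HasCompactSupport φ) (hh : 0 < h) :
    ∀ᶠ x : ℝ in atTop, φ (x * h) = 0 := by
  have hφ : φ =ᶠ[cocompact ℝ] 0 := by
    simpa only [coclosedCompact_eq_cocompact] using hasCompactSupport_iff_eventuallyEq.mp hs
  exact (tendsto_id.atTop_mul_const hh).eventually (hφ.filter_mono atTop_le_cocompact)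

theorem exists_comp_natCast_add_one_mul_eq_zero (hs : HasCompactSupport φ) (hh : 0 < h) :
    ∃ N : ℕ, ∀ n ∉ Finset.range N, φ ((n + 1) * h) = 0 := by
  obtain ⟨a, ha⟩ := eventually_atTop.mp (eventually_comp_mul_eq_zero hs hh)
  obtain ⟨N, hN⟩ := exists_nat_ge a
  refine ⟨N, fun n hn => ha _ ?_⟩
  have hNn : (N : ℝ) ≤ n := by simpa using hn
  linarith

theorem integrableOn_Ioi_of_eventually_eq_zero {f : ℝ → ℂ} (hf : ContinuousOn f (Ici a))
    (h0 : f =ᶠ[atTop] 0) : IntegrableOn f (Ioi a) :=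
  ((hf.locallyIntegrableOn measurableSet_Ici).integrableOn_of_isBigO_atTop
    (h0.trans_isBigO (Asymptotics.isBigO_zero (0 : ℝ → ℂ) _))
    ⟨univ, univ_mem, integrableOn_zero⟩).mono_set Ioi_subset_Ici_self

theorem cutPow_eventuallyEq_zero (hs : HasCompactSupport φ) (hh : 0 < h) (z : ℂ) :
    cutPow φ h z =ᶠ[atTop] 0 := by
  filter_upwards [eventually_comp_mul_eq_zero hs hh] with x hx
  simp [cutPow, hx]

theorem continuousOn_cutPow (hφ : Continuous φ) (h : ℝ) (z : ℂ) :
    ContinuousOn (cutPow φ h z) (Ioi 0) := fun _ hx =>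
  ((Complex.continuousAt_ofReal_cpow_const _ _ (Or.inr (ne_of_gt hx))).mul (Continuous.continuousAt
    (Complex.continuous_ofReal.comp (hφ.comp (continuous_mul_const h))))).continuousWithinAt

theorem integrableOn_cutPow (hφ : Continuous φ) (hs : HasCompactSupport φ) (hh : 0 < h)
    (ha : 0 < a) (z : ℂ) : IntegrableOn (cutPow φ h z) (Ioi a) :=
  integrableOn_Ioi_of_eventually_eq_zero ((continuousOn_cutPow hφ h z).mono (Ici_subset_Ioi.mpr ha))
    (cutPow_eventuallyEq_zero hs hh z)

theorem hasDerivAt_cutPow (hφ : Differentiable ℝ φ) (h : ℝ) (z : ℂ) {x : ℝ} (hx : 0 < x) :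
    HasDerivAt (cutPow φ h z)
      (cutPow (eulerOp φ) h (z + 1) x - z * cutPow φ h (z + 1) x) x := by
  have hx0 : (x : ℂ) ≠ 0 := Complex.ofReal_ne_zero.mpr hx.ne'
  have hpow : HasDerivAt (fun y : ℝ => (y : ℂ) ^ (-z)) (-z * (x : ℂ) ^ (-z - 1)) x := by
    simpa using ((hasDerivAt_id (x : ℂ)).cpow_const (c := -z)
      (Complex.ofReal_mem_slitPlane.mpr hx)).comp_ofReal
  have hcut : HasDerivAt (fun y : ℝ => (φ (y * h) : ℂ)) (deriv φ (x * h) * h : ℝ) x := by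
    simpa [Function.comp_def] using
      ((hφ (x * h)).hasDerivAt.comp x ((hasDerivAt_id x).mul_const h)).ofReal_comp
  convert! hpow.mul hcut using 1
  have hshift : (x : ℂ) ^ (-z) = (x : ℂ) ^ (-(z + 1)) * x := by
    nth_rw 3 [← Complex.cpow_one (x : ℂ)]
    rw [← Complex.cpow_add _ _ hx0, neg_add, neg_add_cancel_right]
  rw [cutPow, cutPow, eulerOp, hshift, ← neg_add']
  push_cast
  ring

theorem integral_periodizedBernoulli_mul_deriv_cutPow (k : ℕ) (hφ : ContDiff ℝ 1 φ)
    (hs : HasCompactSupport φ) (hh : 0 < h) (z : ℂ) :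
    ∫ x in Ioi (1 : ℝ), (periodizedBernoulli k x : ℂ) *
        (cutPow (eulerOp φ) h (z + 1) x - z * cutPow φ h (z + 1) x) =
      bernoulliIntegral k (eulerOp φ) h (z + 1) - z * bernoulliIntegral k φ h (z + 1) := by
  have hE := integrableOn_periodizedBernoulli_mul k (integrableOn_cutPow (continuous_eulerOp hφ)
    (hasCompactSupport_eulerOp hs) hh one_pos (z + 1))
  have hφi := integrableOn_periodizedBernoulli_mul k
    (integrableOn_cutPow hφ.continuous hs hh one_pos (z + 1))
  simp only [bernoulliIntegral]
  rw [← integral_const_mul, ← integral_sub hE (hφi.const_mul z)]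
  simp only [mul_sub, mul_left_comm]

theorem continuousOn_deriv_cutPow (hφ : ContDiff ℝ 1 φ) (h : ℝ) (z : ℂ) :
    ContinuousOn (fun x => cutPow (eulerOp φ) h (z + 1) x - z * cutPow φ h (z + 1) x) (Ioi 0) :=
  (continuousOn_cutPow (continuous_eulerOp hφ) h _).sub
    ((continuousOn_cutPow hφ.continuous h _).const_mul z)

theorem integrableOn_deriv_cutPow (hφ : ContDiff ℝ 1 φ) (hs : HasCompactSupport φ) (hh : 0 < h)
    (ha : 0 < a) (z : ℂ) :
    IntegrableOn (fun x => cutPow (eulerOp φ) h (z + 1) x - z * cutPow φ h (z + 1) x) (Ioi a) :=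
  (integrableOn_cutPow (continuous_eulerOp hφ) (hasCompactSupport_eulerOp hs) hh ha _).sub
    ((integrableOn_cutPow hφ.continuous hs hh ha _).const_mul z)

theorem bernoulliIntegral_eq {k : ℕ} (hk : k ≠ 0) (hφ : ContDiff ℝ 1 φ)
    (hs : HasCompactSupport φ) (hh : 0 < h) (z : ℂ) :
    bernoulliIntegral k φ h z = (bernoulliFun (k + 1) 0 : ℂ) / (k + 1) * (0 - φ h)
      - 1 / (k + 1) * (bernoulliIntegral (k + 1) (eulerOp φ) h (z + 1)
        - z * bernoulliIntegral (k + 1) φ h (z + 1)) := by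
  have hsub : Ici ((1 : ℕ) : ℝ) ⊆ Ioi 0 := Ici_subset_Ioi.mpr (by simp)
  have step := integral_periodizedBernoulli_mul_Ioi hk 1
    (fun x hx => hasDerivAt_cutPow (hφ.differentiable one_ne_zero) h z (hsub hx))
    ((continuousOn_deriv_cutPow hφ h z).mono hsub)
    (integrableOn_cutPow hφ.continuous hs hh (by simp) z)
    (integrableOn_deriv_cutPow hφ hs hh (by simp) z)
    (tendsto_const_nhds.congr' (cutPow_eventuallyEq_zero hs hh z).symm)
  rw [Nat.cast_one, integral_periodizedBernoulli_mul_deriv_cutPow (k + 1) hφ hs hh] at step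
  simpa [bernoulliIntegral, cutPow] using step

theorem sumSubIntegral_eq (hφ : ContDiff ℝ 1 φ) (hs : HasCompactSupport φ) (hh : 0 < h) (z : ℂ) :
    sumSubIntegral φ h z = (0 + φ h) / 2 +
      (bernoulliIntegral 1 (eulerOp φ) h (z + 1) - z * bernoulliIntegral 1 φ h (z + 1)) := by
  have hsub : Ici (1 : ℝ) ⊆ Ioi 0 := Ici_subset_Ioi.mpr one_pos
  have hsum : Summable fun n : ℕ => cutPow φ h z (n + 1) := by
    obtain ⟨N, hN⟩ := exists_comp_natCast_add_one_mul_eq_zero hs hh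
    exact summable_of_ne_finset_zero (s := Finset.range N) fun n hn => by simp [cutPow, hN n hn]
  have step := tsum_sub_integral_Ioi_one
    (fun x hx => hasDerivAt_cutPow (hφ.differentiable one_ne_zero) h z (hsub hx))
    ((continuousOn_deriv_cutPow hφ h z).mono hsub) hsum
    (integrableOn_cutPow hφ.continuous hs hh one_pos z)
    (integrableOn_deriv_cutPow hφ hs hh one_pos z)
    (tendsto_const_nhds.congr' (cutPow_eventuallyEq_zero hs hh z).symm)
  rw [integral_periodizedBernoulli_mul_deriv_cutPow 1 hφ hs hh] at step
  simpa [sumSubIntegral, cutPow] using step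

end CutPow

section LocallyUniformLimit

theorem tendstoLocallyUniformlyOn_mul_left {X ι R : Type*} [TopologicalSpace X] [SeminormedRing R]
    [NormMulClass R] {l : Filter ι} {s : Set X} {c G : X → R} {F : ι → X → R}
    (hc : ContinuousOn c s) (hF : TendstoLocallyUniformlyOn F G l s) :
    TendstoLocallyUniformlyOn (fun i x => c x * F i x) (fun x => c x * G x) l s := by
  rw [tendstoLocallyUniformlyOn_iff_forall_tendsto] at hF ⊢
  intro x hx
  have hdist := tendsto_uniformity_iff_dist_tendsto_zero.mp (hF x hx)
  have hnorm := (hc x hx).norm.tendsto.comp (tendsto_snd (f := l))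
  rw [tendsto_uniformity_iff_dist_tendsto_zero]
  simpa [dist_eq_norm, ← mul_sub, Function.comp_def] using hnorm.mul hdist

theorem exists_tendstoLocallyUniformlyOn_of_eq_shift {ι : Type*} {l : Filter ι} {σ : ℝ}
    {c : ι → ℂ} {c₀ : ℂ} {A B F : ι → ℂ → ℂ} (b : ℂ) (hc : Tendsto c l (𝓝 c₀))
    (hA : ∃ G, TendstoLocallyUniformlyOn A G l {z | σ < z.re})
    (hB : ∃ G, TendstoLocallyUniformlyOn B G l {z | σ < z.re})
    (hF : ∀ᶠ i in l, ∀ z, F i z = c i + b * (A i (z + 1) - z * B i (z + 1))) :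
    ∃ G, TendstoLocallyUniformlyOn F G l {z | σ - 1 < z.re} := by
  obtain ⟨A₀, hA⟩ := hA
  obtain ⟨B₀, hB⟩ := hB
  have hmaps : MapsTo (fun z : ℂ => z + 1) {z | σ - 1 < z.re} {z | σ < z.re} := fun z hz => by
    simpa [sub_lt_iff_lt_add] using hz
  have hshift : ContinuousOn (fun z : ℂ => z + 1) {z | σ - 1 < z.re} := by fun_prop
  have hconst := (hc.tendstoUniformlyOn_const {z : ℂ | σ - 1 < z.re}).tendstoLocallyUniformlyOn
  have hdiff := (hA.comp _ hmaps hshift).sub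
    (tendstoLocallyUniformlyOn_mul_left continuousOn_id (hB.comp _ hmaps hshift))
  refine ⟨_, (hconst.add (tendstoLocallyUniformlyOn_mul_left (continuousOn_const (c := b))
    hdiff)).congr_inseparable ?_⟩
  filter_upwards [hF] with i hi z _
  exact .of_eq (hi z).symm

variable {φ : ℝ → ℝ} {h σ : ℝ}

theorem exists_forall_abs_sub_le (hφ : Continuous φ) (hs : HasCompactSupport φ) :
    ∃ C, ∀ x y, |φ x - φ y| ≤ C := by
  obtain ⟨C, hC⟩ := hs.exists_bound_of_continuous hφ
  exact ⟨C + C, fun x y => (abs_sub _ _).trans (add_le_add (hC x) (hC y))⟩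

theorem integrableOn_rpow_mul_abs_sub (hφ : Continuous φ) (hs : HasCompactSupport φ)
    (hσ : 1 < σ) (h : ℝ) :
    IntegrableOn (fun x : ℝ => x ^ (-σ) * |φ (x * h) - φ 0|) (Ioi 1) := by
  obtain ⟨C, hC⟩ := exists_forall_abs_sub_le hφ hs
  refine (integrableOn_Ioi_rpow_of_lt (neg_lt_neg hσ) one_pos).mul_bdd (c := C)
    (Continuous.aestronglyMeasurable (by fun_prop)) (Eventually.of_forall fun x => ?_)
  simpa using hC (x * h) 0

theorem tendsto_integral_rpow_mul_abs_sub (hφ : Continuous φ) (hs : HasCompactSupport φ)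
    (hσ : 1 < σ) :
    Tendsto (fun h : ℝ => ∫ x in Ioi (1 : ℝ), x ^ (-σ) * |φ (x * h) - φ 0|) (𝓝 0) (𝓝 0) := by
  obtain ⟨C, hC⟩ := exists_forall_abs_sub_le hφ hs
  have hdom := tendsto_integral_filter_of_dominated_convergence (μ := volume.restrict (Ioi (1 : ℝ)))
    (l := 𝓝 (0 : ℝ)) (F := fun h x => x ^ (-σ) * |φ (x * h) - φ 0|) (f := fun _ => (0 : ℝ))
    (fun x => x ^ (-σ) * C)
    (Eventually.of_forall fun h => (integrableOn_rpow_mul_abs_sub hφ hs hσ h).aestronglyMeasurable)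
    (Eventually.of_forall fun h => ?_)
    ((integrableOn_Ioi_rpow_of_lt (neg_lt_neg hσ) one_pos).mul_const C)
    (Eventually.of_forall fun x => ?_)
  · simpa using hdom
  · filter_upwards [ae_restrict_mem measurableSet_Ioi] with x hx
    have hx0 : 0 ≤ x ^ (-σ) := Real.rpow_nonneg (one_pos.trans hx).le _
    rw [Real.norm_of_nonneg (by positivity)]
    exact mul_le_mul_of_nonneg_left (hC _ _) hx0
  · have hcont : Continuous fun h : ℝ => x ^ (-σ) * |φ (x * h) - φ 0| := by fun_prop
    simpa using hcont.tendsto 0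

theorem norm_cutPow_sub_le (φ : ℝ → ℝ) (h : ℝ) {x : ℝ} {z : ℂ} (hx : 1 ≤ x) (hz : σ ≤ z.re) :
    ‖cutPow φ h z x - φ 0 * (x : ℂ) ^ (-z)‖ ≤ x ^ (-σ) * |φ (x * h) - φ 0| := by
  rw [cutPow, mul_comm (φ 0 : ℂ), ← mul_sub, norm_mul,
    Complex.norm_cpow_eq_rpow_re_of_pos (one_pos.trans_le hx), ← Complex.ofReal_sub,
    Complex.norm_real, Real.norm_eq_abs]
  exact mul_le_mul_of_nonneg_right
    (Real.rpow_le_rpow_of_exponent_le hx (neg_le_neg hz)) (abs_nonneg _)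

theorem norm_integral_cutPow_sub_le {b : ℝ → ℝ} {C : ℝ} (hφ : Continuous φ)
    (hs : HasCompactSupport φ) (hb : Measurable b) (hC : ∀ x, |b x| ≤ C) (hh : 0 < h)
    (hσ : 1 < σ) {z : ℂ} (hz : σ ≤ z.re) :
    ‖(∫ x in Ioi (1 : ℝ), (b x : ℂ) * cutPow φ h z x)
        - ∫ x in Ioi (1 : ℝ), (b x : ℂ) * (φ 0 * (x : ℂ) ^ (-z))‖ ≤
      C * ∫ x in Ioi (1 : ℝ), x ^ (-σ) * |φ (x * h) - φ 0| := by
  have hbm : AEStronglyMeasurable (fun x => (b x : ℂ)) (volume.restrict (Ioi 1)) :=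
    (Complex.measurable_ofReal.comp hb).aestronglyMeasurable
  have hbC : ∀ᵐ x ∂volume.restrict (Ioi (1 : ℝ)), ‖(b x : ℂ)‖ ≤ C :=
    Eventually.of_forall fun x => by simpa using hC x
  have hcut := (integrableOn_cutPow hφ hs hh one_pos z).bdd_mul hbm hbC
  have hpow := ((integrableOn_Ioi_cpow_of_lt (a := -z)
    (neg_lt_neg (hσ.trans_le hz)) one_pos).const_mul (φ 0 : ℂ)).bdd_mul hbm hbC
  rw [← integral_sub hcut hpow, ← integral_const_mul]
  refine norm_integral_le_of_norm_le
    ((integrableOn_rpow_mul_abs_sub hφ hs hσ h).const_mul C) ?_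
  filter_upwards [ae_restrict_mem measurableSet_Ioi] with x hx
  rw [← mul_sub, norm_mul, Complex.norm_real, Real.norm_eq_abs]
  exact mul_le_mul (hC x) (norm_cutPow_sub_le φ h (le_of_lt hx) hz) (norm_nonneg _)
    ((abs_nonneg _).trans (hC x))

theorem tendstoLocallyUniformlyOn_integral_cutPow {b : ℝ → ℝ} {C : ℝ} (hφ : Continuous φ)
    (hs : HasCompactSupport φ) (hb : Measurable b) (hC : ∀ x, |b x| ≤ C) :
    TendstoLocallyUniformlyOn
      (fun h z => ∫ x in Ioi (1 : ℝ), (b x : ℂ) * cutPow φ h z x)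
      (fun z => ∫ x in Ioi (1 : ℝ), (b x : ℂ) * (φ 0 * (x : ℂ) ^ (-z)))
      (𝓝[>] 0) {z | 1 < z.re} := by
  refine tendstoLocallyUniformlyOn_of_forall_exists_nhds fun w hw => ?_
  obtain ⟨σ, hσ, hσw⟩ := exists_between (show (1 : ℝ) < w.re from hw)
  refine ⟨{z | σ < z.re}, mem_nhdsWithin_of_mem_nhds
    ((isOpen_lt continuous_const Complex.continuous_re).mem_nhds hσw), ?_⟩
  rw [Metric.tendstoUniformlyOn_iff]
  intro ε hε
  have hbound := ((tendsto_integral_rpow_mul_abs_sub hφ hs hσ).const_mul C).mono_left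
    (nhdsWithin_le_nhds (s := Ioi 0))
  rw [mul_zero] at hbound
  filter_upwards [hbound.eventually_lt_const hε, self_mem_nhdsWithin] with h hlt hh z hz
  rw [dist_comm, dist_eq_norm]
  exact (norm_integral_cutPow_sub_le hφ hs hb hC hh hσ (le_of_lt hz)).trans_lt hlt

theorem exists_tendstoLocallyUniformlyOn_bernoulliIntegral (m : ℕ) :
    ∀ {k : ℕ} {φ : ℝ → ℝ}, k ≠ 0 → ContDiff ℝ m φ → HasCompactSupport φ →
      ∃ G, TendstoLocallyUniformlyOn (bernoulliIntegral k φ) G (𝓝[>] 0) {z | 1 - m < z.re} := by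
  induction m with
  | zero =>
    intro k φ _ hφ hs
    obtain ⟨C, hC⟩ := exists_abs_periodizedBernoulli_coe_le k
    refine ⟨fun z => ∫ x in Ioi (1 : ℝ),
      (periodizedBernoulli k x : ℂ) * (φ 0 * (x : ℂ) ^ (-z)), ?_⟩
    simpa using! tendstoLocallyUniformlyOn_integral_cutPow hφ.continuous hs
      (measurable_periodizedBernoulli_coe k) hC
  | succ m ih =>
    intro k φ hk hφ hs
    have hφm : ContDiff ℝ m φ := hφ.of_le (by exact_mod_cast m.le_succ)
    have hφ1 : ContDiff ℝ 1 φ := hφ.of_le (by exact_mod_cast m.succ_pos)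
    have hboundary : Continuous fun h : ℝ =>
        (bernoulliFun (k + 1) 0 : ℂ) / (k + 1) * (0 - φ h) :=
      continuous_const.mul (continuous_const.sub (Complex.continuous_ofReal.comp hφ.continuous))
    have hF : ∀ᶠ h : ℝ in 𝓝[>] 0, ∀ z, bernoulliIntegral k φ h z =
        (bernoulliFun (k + 1) 0 : ℂ) / (k + 1) * (0 - φ h) + -(1 / (k + 1)) *
          (bernoulliIntegral (k + 1) (eulerOp φ) h (z + 1)
            - z * bernoulliIntegral (k + 1) φ h (z + 1)) := by
      filter_upwards [self_mem_nhdsWithin] with h hh z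
      rw [bernoulliIntegral_eq hk hφ1 hs hh, neg_mul, sub_eq_add_neg]
    obtain ⟨G, hG⟩ := exists_tendstoLocallyUniformlyOn_of_eq_shift _
      ((hboundary.tendsto 0).mono_left nhdsWithin_le_nhds)
      (ih k.succ_ne_zero (contDiff_eulerOp hφ) (hasCompactSupport_eulerOp hs))
      (ih k.succ_ne_zero hφm hs) hF
    exact ⟨G, by simpa [sub_sub] using hG⟩

theorem exists_tendstoLocallyUniformlyOn_sumSubIntegral {m : ℕ} (hm : m ≠ 0)
    (hφ : ContDiff ℝ m φ) (hs : HasCompactSupport φ) :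
    ∃ G, TendstoLocallyUniformlyOn (sumSubIntegral φ) G (𝓝[>] 0) {z | 1 - m < z.re} := by
  obtain ⟨m, rfl⟩ := Nat.exists_eq_succ_of_ne_zero hm
  have hφm : ContDiff ℝ m φ := hφ.of_le (by exact_mod_cast m.le_succ)
  have hφ1 : ContDiff ℝ 1 φ := hφ.of_le (by exact_mod_cast m.succ_pos)
  have hboundary : Continuous fun h : ℝ => (0 + φ h : ℂ) / 2 :=
    (continuous_const.add (Complex.continuous_ofReal.comp hφ.continuous)).div_const _
  have hF : ∀ᶠ h : ℝ in 𝓝[>] 0, ∀ z, sumSubIntegral φ h z = (0 + φ h) / 2 +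
      1 * (bernoulliIntegral 1 (eulerOp φ) h (z + 1) - z * bernoulliIntegral 1 φ h (z + 1)) := by
    filter_upwards [self_mem_nhdsWithin] with h hh z
    rw [sumSubIntegral_eq hφ1 hs hh, one_mul]
  obtain ⟨G, hG⟩ := exists_tendstoLocallyUniformlyOn_of_eq_shift _
    ((hboundary.tendsto 0).mono_left nhdsWithin_le_nhds)
    (exists_tendstoLocallyUniformlyOn_bernoulliIntegral m one_ne_zero (contDiff_eulerOp hφ)
      (hasCompactSupport_eulerOp hs))
    (exists_tendstoLocallyUniformlyOn_bernoulliIntegral m one_ne_zero hφm hs) hF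
  exact ⟨G, by simpa [sub_sub] using hG⟩

end LocallyUniformLimit

section ZetaLimit

variable {φ : ℝ → ℝ} {h : ℝ} {z : ℂ}

theorem logIntegrand_eq (φ : ℝ → ℝ) (z : ℂ) (h x : ℝ) :
    logIntegrand φ z h x = -(Real.log x : ℂ) * cutPow φ h z x := by
  rw [logIntegrand, cutPow]
  ring

theorem continuousOn_logIntegrand (hφ : Continuous φ) (z : ℂ) (h : ℝ) :
    ContinuousOn (logIntegrand φ z h) (Ioi 0) := by
  refine ContinuousOn.congr ?_ fun x _ => logIntegrand_eq φ z h x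
  exact (Complex.continuous_ofReal.comp_continuousOn
    (Real.continuousOn_log.mono fun x hx => ne_of_gt hx)).neg.mul (continuousOn_cutPow hφ h z)

theorem integrableOn_logIntegrand_Ioi (hφ : Continuous φ) (hs : HasCompactSupport φ) (hh : 0 < h)
    (z : ℂ) {a : ℝ} (ha : 0 < a) : IntegrableOn (logIntegrand φ z h) (Ioi a) := by
  refine integrableOn_Ioi_of_eventually_eq_zero
    ((continuousOn_logIntegrand hφ z h).mono (Ici_subset_Ioi.mpr ha)) ?_
  filter_upwards [cutPow_eventuallyEq_zero hs hh z] with x hx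
  rw [logIntegrand_eq, hx, Pi.zero_apply, mul_zero]

theorem norm_logIntegrand_le (φ : ℝ → ℝ) {w : ℂ} (h : ℝ) {x : ℝ} (hx : 1 ≤ x) (hw : z.re ≤ w.re) :
    ‖logIntegrand φ w h x‖ ≤ ‖logIntegrand φ z h x‖ := by
  simp only [logIntegrand, norm_neg, norm_mul,
    Complex.norm_cpow_eq_rpow_re_of_pos (one_pos.trans_le hx), Complex.neg_re]
  gcongr

theorem hasDerivAt_cutPow_exponent (φ : ℝ → ℝ) (h : ℝ) (z : ℂ) {x : ℝ} (hx : 0 < x) :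
    HasDerivAt (fun w => cutPow φ h w x) (logIntegrand φ z h x) z := by
  have hpow := ((hasDerivAt_id z).neg.const_cpow (c := (x : ℂ))
    (Or.inl (Complex.ofReal_ne_zero.mpr hx.ne'))).mul_const (φ (x * h) : ℂ)
  convert! hpow using 1
  rw [logIntegrand, Complex.ofReal_log hx.le]
  simp

theorem hasDerivAt_integral_cutPow (hφ : Continuous φ) (hs : HasCompactSupport φ) (hh : 0 < h)
    (z : ℂ) :
    HasDerivAt (fun w => ∫ x in Ioi (1 : ℝ), cutPow φ h w x)
      (∫ x in Ioi (1 : ℝ), logIntegrand φ z h x) z := by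
  refine (hasDerivAt_integral_of_dominated_loc_of_deriv_le (Metric.ball_mem_nhds z one_pos)
    (F' := fun w => logIntegrand φ w h) (bound := fun x => ‖logIntegrand φ (z - 1) h x‖)
    (Eventually.of_forall fun w => (integrableOn_cutPow hφ hs hh one_pos w).aestronglyMeasurable)
    (integrableOn_cutPow hφ hs hh one_pos z)
    (integrableOn_logIntegrand_Ioi hφ hs hh z one_pos).aestronglyMeasurable ?_
    (integrableOn_logIntegrand_Ioi hφ hs hh (z - 1) one_pos).norm ?_).2
  · filter_upwards [ae_restrict_mem measurableSet_Ioi] with x hx w hw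
    refine norm_logIntegrand_le φ h (le_of_lt hx) ?_
    have hre := (Complex.abs_re_le_norm (w - z)).trans_lt (mem_ball_iff_norm.mp hw)
    rw [Complex.sub_re, abs_lt] at hre
    rw [Complex.sub_re, Complex.one_re]
    linarith
  · filter_upwards [ae_restrict_mem measurableSet_Ioi] with x hx w _
    exact hasDerivAt_cutPow_exponent φ h w (one_pos.trans hx)

theorem hasDerivAt_tsum_cutPow (hs : HasCompactSupport φ) (hh : 0 < h) (z : ℂ) :
    HasDerivAt (fun w => ∑' n : ℕ, cutPow φ h w (n + 1)) (logSum φ z h) z := by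
  obtain ⟨N, hN⟩ := exists_comp_natCast_add_one_mul_eq_zero hs hh
  have hcut : (fun w => ∑' n : ℕ, cutPow φ h w (n + 1)) =
      fun w => ∑ n ∈ Finset.range N, cutPow φ h w (n + 1) :=
    funext fun w => tsum_eq_sum fun n hn => by simp [cutPow, hN n hn]
  rw [hcut, logSum, tsum_eq_sum (s := Finset.range N) fun n hn => by simp [logIntegrand, hN n hn]]
  exact HasDerivAt.fun_sum fun n _ => hasDerivAt_cutPow_exponent φ h z n.cast_add_one_pos

theorem hasDerivAt_sumSubIntegral (hφ : Continuous φ) (hs : HasCompactSupport φ) (hh : 0 < h)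
    (z : ℂ) :
    HasDerivAt (sumSubIntegral φ h) (logSum φ z h - ∫ x in Ioi (1 : ℝ), logIntegrand φ z h x) z :=
  (hasDerivAt_tsum_cutPow hs hh z).sub (hasDerivAt_integral_cutPow hφ hs hh z)

theorem tendsto_cutPow (hφ : Continuous φ) (z : ℂ) (x : ℝ) :
    Tendsto (fun h => cutPow φ h z x) (𝓝 0) (𝓝 (φ 0 * (x : ℂ) ^ (-z))) := by
  have hcont : Continuous fun h : ℝ => cutPow φ h z x :=
    continuous_const.mul (Complex.continuous_ofReal.comp (hφ.comp (continuous_const_mul x)))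
  simpa [cutPow, mul_comm] using hcont.tendsto 0

theorem tendsto_tsum_cutPow (hφ : Continuous φ) (hs : HasCompactSupport φ) (hz : 1 < z.re) :
    Tendsto (fun h => ∑' n : ℕ, cutPow φ h z (n + 1)) (𝓝 0) (𝓝 (φ 0 * riemannZeta z)) := by
  obtain ⟨D, hD⟩ := hs.exists_bound_of_continuous hφ
  have hpow (n : ℕ) : (((n : ℝ) + 1 : ℝ) : ℂ) ^ (-z) = 1 / ((n + 1 : ℕ) : ℂ) ^ z := by
    rw [Complex.cpow_neg, one_div]
    push_cast
    rfl
  have hsum := ((summable_nat_add_iff 1).mpr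
    ((Complex.summable_one_div_nat_cpow (p := z)).mpr hz)).norm.mul_right D
  have hdom := tendsto_tsum_of_dominated_convergence (𝓕 := 𝓝 (0 : ℝ)) hsum
    (fun n => tendsto_cutPow hφ z (n + 1)) (Eventually.of_forall fun h n => ?_)
  · simpa only [hpow, tsum_mul_left, Nat.cast_add_one, zeta_eq_tsum_one_div_nat_add_one_cpow hz]
      using hdom
  · rw [cutPow, norm_mul, hpow, Complex.norm_real]
    exact mul_le_mul_of_nonneg_left (hD _) (norm_nonneg _)

theorem tendsto_sumSubIntegral_of_one_lt_re (hφ : Continuous φ) (hs : HasCompactSupport φ)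
    (hz : 1 < z.re) :
    Tendsto (fun h => sumSubIntegral φ h z) (𝓝[>] 0)
      (𝓝 (φ 0 * (riemannZeta z - 1 / (z - 1)))) := by
  have hint := (tendstoLocallyUniformlyOn_integral_cutPow hφ hs (b := fun _ => 1) (C := 1)
    measurable_const (by simp)).tendsto_at hz
  have hpow : ∫ x in Ioi (1 : ℝ), (x : ℂ) ^ (-z) = 1 / (z - 1) := by
    rw [integral_Ioi_cpow_of_lt (by simpa using hz) one_pos, Complex.ofReal_one, Complex.one_cpow,
      neg_add_eq_sub, ← neg_sub z 1, neg_div_neg_eq]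
  simp only [Complex.ofReal_one, one_mul, integral_const_mul, hpow] at hint
  rw [mul_sub]
  exact ((tendsto_tsum_cutPow hφ hs hz).mono_left nhdsWithin_le_nhds).sub hint

theorem differentiable_update_sub_one_mul_riemannZeta :
    Differentiable ℂ (Function.update (fun s => (s - 1) * riemannZeta s) 1 1) := by
  rw [← differentiableOn_univ, ← Complex.differentiableOn_compl_singleton_and_continuousAt_iff
    (univ_mem : univ ∈ 𝓝 (1 : ℂ))]
  refine ⟨?_, continuousAt_update_same.mpr riemannZeta_residue_one⟩
  refine DifferentiableOn.congr (f := fun s => (s - 1) * riemannZeta s) (fun s hs => ?_)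
    fun s hs => Function.update_of_ne hs.2 _ _
  exact (((differentiableAt_id.sub_const 1).mul
    (differentiableAt_riemannZeta hs.2))).differentiableWithinAt

/-- Identity theorem, applied after multiplying by `w - 1` to remove the pole. -/
theorem eq_riemannZeta_sub_of_differentiableOn {U : Set ℂ} {G : ℂ → ℂ} {a : ℂ} (hUo : IsOpen U)
    (hUc : IsPreconnected U) (hU : {w | 1 < w.re} ⊆ U) (hG : DifferentiableOn ℂ G U)
    (hGζ : ∀ w : ℂ, 1 < w.re → G w = a * (riemannZeta w - 1 / (w - 1))) {w : ℂ} (hw : w ∈ U)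
    (hw1 : w ≠ 1) : G w = a * (riemannZeta w - 1 / (w - 1)) := by
  have hne {v : ℂ} (hv : v ≠ 1) : v - 1 ≠ 0 := sub_ne_zero.mpr hv
  have hEq : EqOn (fun v => (v - 1) * G v + a)
      (fun v => a * Function.update (fun s => (s - 1) * riemannZeta s) 1 1 v) U := by
    refine AnalyticOnNhd.eqOn_of_preconnected_of_eventuallyEq (𝕜 := ℂ) (z₀ := 2)
      ((((differentiableOn_id.sub_const 1).mul hG).add_const a).analyticOnNhd hUo)
      ((differentiable_update_sub_one_mul_riemannZeta.const_mul a).differentiableOn.analyticOnNhd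
        hUo) hUc (hU (by simp)) ?_
    filter_upwards [(isOpen_lt continuous_const Complex.continuous_re).mem_nhds
      (by simp : (1 : ℝ) < (2 : ℂ).re)] with v hv
    have hv1 : v ≠ 1 := fun h => by simp [h] at hv
    rw [Function.update_of_ne hv1, hGζ v hv]
    field_simp [hne hv1]
    ring
  have hEqw := hEq hw
  simp only [Function.update_of_ne hw1] at hEqw
  have := hne hw1
  field_simp
  linear_combination hEqw

theorem deriv_riemannZeta_sub_one_div (hz : z ≠ 1) :
    deriv (fun w => riemannZeta w - 1 / (w - 1)) z = deriv riemannZeta z + 1 / (z - 1) ^ 2 := by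
  have hinv := ((hasDerivAt_id z).sub_const 1).inv (sub_ne_zero.mpr hz)
  simp only [one_div]
  refine ((differentiableAt_riemannZeta hz).hasDerivAt.sub hinv).deriv.trans ?_
  simp [neg_div]

theorem tendsto_logSum_sub_integral_Ioi_one {m : ℕ} (hm : m ≠ 0) (hφ : ContDiff ℝ m φ)
    (hs : HasCompactSupport φ) (hz : 1 - m < z.re) (hz1 : z ≠ 1) :
    Tendsto (fun h => logSum φ z h - ∫ x in Ioi (1 : ℝ), logIntegrand φ z h x) (𝓝[>] 0)
      (𝓝 (φ 0 * (deriv riemannZeta z + 1 / (z - 1) ^ 2))) := by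
  obtain ⟨G, hG⟩ := exists_tendstoLocallyUniformlyOn_sumSubIntegral hm hφ hs
  have hUo : IsOpen {w : ℂ | 1 - (m : ℝ) < w.re} :=
    isOpen_lt continuous_const Complex.continuous_re
  have hU : {w : ℂ | 1 < w.re} ⊆ {w | 1 - (m : ℝ) < w.re} :=
    fun w (hw : 1 < w.re) => show 1 - (m : ℝ) < w.re from
      (sub_le_self _ m.cast_nonneg).trans_lt hw
  have hderiv : ∀ᶠ h in 𝓝[>] (0 : ℝ), ∀ w, HasDerivAt (sumSubIntegral φ h)
      (logSum φ w h - ∫ x in Ioi (1 : ℝ), logIntegrand φ w h x) w := by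
    filter_upwards [self_mem_nhdsWithin] with h hh
    exact hasDerivAt_sumSubIntegral hφ.continuous hs hh
  have hd : ∀ᶠ h in 𝓝[>] (0 : ℝ),
      DifferentiableOn ℂ (sumSubIntegral φ h) {w | 1 - (m : ℝ) < w.re} :=
    hderiv.mono fun h hh w _ => (hh w).differentiableAt.differentiableWithinAt
  have hGζ : G =ᶠ[𝓝 z] fun w => φ 0 * (riemannZeta w - 1 / (w - 1)) := by
    filter_upwards [hUo.mem_nhds hz, isOpen_ne.mem_nhds hz1] with w hw hw1
    exact eq_riemannZeta_sub_of_differentiableOn hUo (convex_halfSpace_re_gt _).isPreconnected hU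
      (hG.differentiableOn hd hUo) (fun v hv => tendsto_nhds_unique (hG.tendsto_at (hU hv))
        (tendsto_sumSubIntegral_of_one_lt_re hφ.continuous hs hv)) hw hw1
  have hlim := (hG.deriv hd hUo).tendsto_at hz
  rw [hGζ.deriv_eq, deriv_const_mul_field, deriv_riemannZeta_sub_one_div hz1] at hlim
  exact hlim.congr' (hderiv.mono fun h hh => (hh z).deriv)

end ZetaLimit

section FinitePart

variable {f g : ℝ → ℂ} {L M : ℂ}

theorem HasFinitePart.congr (hf : HasFinitePart f L) (hfg : EqOn f g (Ioi 0)) :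
    HasFinitePart g L := by
  have hE {ε : ℝ} (hε : 0 < ε) : EqOn f g (Ioi ε) := hfg.mono (Ioi_subset_Ioi hε.le)
  obtain ⟨hi, S, c, hS, hc⟩ := hf
  refine ⟨fun ε hε => (hi ε hε).congr_fun (hE hε) measurableSet_Ioi, S, c, hS, hc.congr' ?_⟩
  filter_upwards [self_mem_nhdsWithin] with ε hε
  rw [setIntegral_congr_fun measurableSet_Ioi (hE hε)]

theorem HasFinitePart.const_mul (hf : HasFinitePart f L) (a : ℂ) :
    HasFinitePart (fun x => a * f x) (a * L) := by
  obtain ⟨hi, S, c, hS, hc⟩ := hf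
  refine ⟨fun ε hε => (hi ε hε).const_mul a, S, fun q => a * c q, hS, (hc.const_mul a).congr ?_⟩
  intro ε
  simp only [integral_const_mul, mul_sub, Finset.mul_sum, mul_assoc]

theorem HasFinitePart.add (hf : HasFinitePart f L) (hg : HasFinitePart g M) :
    HasFinitePart (fun x => f x + g x) (L + M) := by
  classical
  obtain ⟨hi, S, c, hS, hc⟩ := hf
  obtain ⟨hi', S', c', hS', hc'⟩ := hg
  refine ⟨fun ε hε => (hi ε hε).add (hi' ε hε), S ∪ S',
    fun q => (if q ∈ S then c q else 0) + (if q ∈ S' then c' q else 0),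
    fun q hq => (Finset.mem_union.mp hq).elim (hS q) (hS' q), (hc.add hc').congr' ?_⟩
  filter_upwards [self_mem_nhdsWithin] with ε hε
  rw [integral_add (hi ε hε) (hi' ε hε)]
  simp only [add_mul, ite_mul, zero_mul, Finset.sum_add_distrib, Finset.sum_ite_mem,
    Finset.union_inter_cancel_left, Finset.union_inter_cancel_right]
  ring

theorem hasFinitePart_zero : HasFinitePart (fun _ => 0) 0 :=
  ⟨fun _ _ => integrableOn_zero, ∅, 0, by simp, by simp⟩

theorem HasFinitePart.sum {ι : Type*} {s : Finset ι} {f : ι → ℝ → ℂ} {L : ι → ℂ}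
    (hf : ∀ i ∈ s, HasFinitePart (f i) (L i)) :
    HasFinitePart (fun x => ∑ i ∈ s, f i x) (∑ i ∈ s, L i) := by
  classical
  induction s using Finset.induction_on with
  | empty => simpa using hasFinitePart_zero
  | insert a s ha ih =>
    simp only [Finset.sum_insert ha]
    exact (hf a (s.mem_insert_self a)).add (ih fun i hi => hf i (Finset.mem_insert_of_mem hi))

theorem hasFinitePart_indicator_of_integrableOn {s : Set ℝ} (hs : MeasurableSet s)
    (hs0 : s ⊆ Ioi 0) (hf : IntegrableOn f s) :
    HasFinitePart (s.indicator f) (∫ x in s, f x) := by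
  have hfin := hasFinitePart_of_integrableOn ((integrable_indicator_iff hs).mpr hf).integrableOn
  rwa [setIntegral_indicator hs, inter_eq_right.mpr hs0] at hfin

theorem HasFinitePart.add_integral_Ioi_one (hf : HasFinitePart ((Ioc 0 1).indicator f) L)
    (hf1 : IntegrableOn f (Ioi 1)) : HasFinitePart f (L + ∫ x in Ioi (1 : ℝ), f x) := by
  refine (hf.add (hasFinitePart_indicator_of_integrableOn measurableSet_Ioi
    (Ioi_subset_Ioi zero_le_one) hf1)).congr fun x hx => ?_
  rw [← Ioc_union_Ioi_eq_Ioi zero_le_one] at hx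
  exact (congrFun (indicator_union_of_disjoint (Ioc_disjoint_Ioi le_rfl) f) x).symm.trans
    (indicator_of_mem hx f)

theorem hasFinitePart_indicator_Ioc_of_hasDerivAt {F : ℝ → ℂ} (hf : ContinuousOn f (Ioi 0))
    (hF : ∀ x, 0 < x → HasDerivAt F (f x) x) {S : Finset (ℂ × ℕ)} (c : ℂ × ℕ → ℂ)
    (hS : ∀ q ∈ S, q.1.re ≤ 0 ∧ q ≠ (0, 0))
    (hlim : Tendsto (fun ε : ℝ => F ε - ∑ q ∈ S, c q * ((ε : ℂ) ^ q.1 * (Real.log ε : ℂ) ^ q.2))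
      (𝓝[>] 0) (𝓝 M)) :
    HasFinitePart ((Ioc 0 1).indicator f) (F 1 - M) := by
  have hinter {ε : ℝ} (hε : 0 < ε) : Ioc 0 1 ∩ Ioi ε = Ioc ε 1 := by
    rw [Ioc_inter_Ioi, max_eq_right hε.le]
  have hpos {ε : ℝ} (hε : 0 < ε) : Icc ε 1 ⊆ Ioi 0 := fun x hx => hε.trans_le hx.1
  refine ⟨fun ε hε => ?_, S, -c, hS, (hlim.const_sub (F 1)).congr' ?_⟩
  · rw [IntegrableOn, integrable_indicator_iff measurableSet_Ioc, IntegrableOn,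
      Measure.restrict_restrict measurableSet_Ioc, hinter hε]
    exact ((hf.mono (hpos hε)).integrableOn_Icc).mono_set Ioc_subset_Icc_self
  · filter_upwards [Ioo_mem_nhdsGT one_pos] with ε hε
    have hsub : uIcc ε 1 ⊆ Ioi 0 := by
      rw [uIcc_of_le hε.2.le]
      exact hpos hε.1
    rw [setIntegral_indicator measurableSet_Ioc, inter_comm, hinter hε.1,
      ← intervalIntegral.integral_of_le hε.2.le, intervalIntegral.integral_eq_sub_of_hasDerivAt
        (fun x hx => hF x (hsub hx)) (hf.mono hsub).intervalIntegrable]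
    simp only [Pi.neg_apply, neg_mul, Finset.sum_neg_distrib]
    ring

end FinitePart

section LogMoment

variable {s : ℂ}

/-- The finite part of `∫ x in 0..1, x ^ (s - 1) * log x`, which is `-1 / s ^ 2` off the pole. At
`s = 0` the integral from `ε` to `1` is the pure power `-(log ε) ^ 2 / 2`, whose finite part is `0`;
this is also the junk value of `-1 / 0 ^ 2`. -/
noncomputable def logMoment (s : ℂ) : ℂ := -1 / s ^ 2

theorem continuousOn_cpow_mul_log (s : ℂ) :
    ContinuousOn (fun x : ℝ => (x : ℂ) ^ s * (Real.log x : ℂ)) (Ioi 0) := fun _ hx =>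
  ((Complex.continuousAt_ofReal_cpow_const _ _ (Or.inr (ne_of_gt hx))).mul
    (Real.continuousAt_log (ne_of_gt hx)).ofReal).continuousWithinAt

theorem hasDerivAt_cpow_mul_log_primitive (hs : s ≠ 0) {x : ℝ} (hx : 0 < x) :
    HasDerivAt (fun x : ℝ => (x : ℂ) ^ s * (Real.log x : ℂ) / s - (x : ℂ) ^ s / s ^ 2)
      ((x : ℂ) ^ (s - 1) * (Real.log x : ℂ)) x := by
  have hx0 : (x : ℂ) ≠ 0 := Complex.ofReal_ne_zero.mpr hx.ne'
  have hpow := hasDerivAt_ofReal_cpow_const hx.ne' hs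
  have hlog := (Real.hasDerivAt_log hx.ne').ofReal_comp
  convert! ((hpow.mul hlog).div_const s).sub (hpow.div_const (s ^ 2)) using 1
  have hshift : (x : ℂ) ^ s = (x : ℂ) ^ (s - 1) * x := by
    rw [Complex.cpow_sub _ _ hx0, Complex.cpow_one, div_mul_cancel₀ _ hx0]
  rw [hshift]
  push_cast
  field_simp
  ring

theorem hasDerivAt_log_sq_div_two {x : ℝ} (hx : 0 < x) :
    HasDerivAt (fun x : ℝ => (Real.log x : ℂ) ^ 2 / 2)
      ((x : ℂ) ^ ((0 : ℂ) - 1) * (Real.log x : ℂ)) x := by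
  convert! ((Real.hasDerivAt_log hx.ne').ofReal_comp.pow 2).div_const 2 using 1
  rw [zero_sub, Complex.cpow_neg_one]
  push_cast
  ring

theorem tendsto_cpow_mul_log_nhdsGT_zero (hs : 0 < s.re) :
    Tendsto (fun x : ℝ => (x : ℂ) ^ s * (Real.log x : ℂ)) (𝓝[>] 0) (𝓝 0) := by
  rw [tendsto_zero_iff_norm_tendsto_zero]
  refine (tendsto_log_mul_rpow_nhdsGT_zero hs).norm.congr' ?_ |>.trans_eq (by simp)
  filter_upwards [self_mem_nhdsWithin] with x hx
  rw [norm_mul, norm_mul, Complex.norm_cpow_eq_rpow_re_of_pos hx, mul_comm, Complex.norm_real,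
    Real.norm_of_nonneg (Real.rpow_nonneg (le_of_lt hx) _)]

theorem tendsto_cpow_nhdsGT_zero (hs : 0 < s.re) :
    Tendsto (fun x : ℝ => (x : ℂ) ^ s) (𝓝[>] 0) (𝓝 0) := by
  have hs0 : s ≠ 0 := fun h => by simp [h] at hs
  simpa [Complex.zero_cpow hs0] using
    (Complex.continuousAt_ofReal_cpow_const 0 s (Or.inl hs)).tendsto.mono_left
      (nhdsWithin_le_nhds (s := Ioi 0))

theorem hasFinitePart_indicator_cpow_mul_log (s : ℂ) :
    HasFinitePart ((Ioc (0 : ℝ) 1).indicator (fun x => (x : ℂ) ^ (s - 1) * (Real.log x : ℂ)))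
      (logMoment s) := by
  have hcont := continuousOn_cpow_mul_log (s - 1)
  rcases eq_or_ne s 0 with rfl | hs
  · simpa [logMoment] using hasFinitePart_indicator_Ioc_of_hasDerivAt (S := {(0, 2)}) (M := 0) hcont
      (fun x => hasDerivAt_log_sq_div_two) (fun _ => 1 / 2) (by simp)
      (tendsto_const_nhds.congr fun ε => by
        simp only [Finset.sum_singleton, Complex.cpow_zero]
        ring)
  have hprim := fun x (hx : 0 < x) => hasDerivAt_cpow_mul_log_primitive hs hx
  rcases le_or_gt s.re 0 with hre | hre
  · simpa [logMoment, neg_div] using hasFinitePart_indicator_Ioc_of_hasDerivAt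
      (S := {(s, 0), (s, 1)}) (M := 0) hcont hprim
      (fun q => if q.2 = 0 then -(1 / s ^ 2) else 1 / s) (by simp [hre, hs])
      (tendsto_const_nhds.congr fun ε => by
        rw [Finset.sum_pair (by simp)]
        simp only [if_true, one_ne_zero, if_false, pow_zero, pow_one]
        ring)
  · have hlim := ((tendsto_cpow_mul_log_nhdsGT_zero hre).div_const s).sub
      ((tendsto_cpow_nhdsGT_zero hre).div_const (s ^ 2))
    simpa [logMoment, neg_div] using hasFinitePart_indicator_Ioc_of_hasDerivAt (S := ∅) (M := 0)
      hcont hprim 0 (by simp) (by simpa using hlim)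

theorem integrableOn_Ioc_cpow_mul_log (hs : 0 < s.re) :
    IntegrableOn (fun x : ℝ => (x : ℂ) ^ (s - 1) * (Real.log x : ℂ)) (Ioc 0 1) := by
  have ht : 0 < s.re / 2 := half_pos hs
  have hpow : IntegrableOn (fun x : ℝ => x ^ (s.re / 2 - 1)) (Ioc 0 1) :=
    (intervalIntegrable_iff_integrableOn_Ioc_of_le zero_le_one).mp
      (intervalIntegral.intervalIntegrable_rpow' (by linarith))
  refine Integrable.mono' (hpow.mul_const (1 / (s.re / 2)))
    (((continuousOn_cpow_mul_log _).mono Ioc_subset_Ioi_self).aestronglyMeasurable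
      measurableSet_Ioc) ?_
  filter_upwards [ae_restrict_mem measurableSet_Ioc] with x hx
  have hsplit : x ^ (s.re - 1) = x ^ (s.re / 2 - 1) * x ^ (s.re / 2) := by
    rw [← Real.rpow_add hx.1]
    ring_nf
  have hlog := (Real.abs_log_mul_self_rpow_lt x _ hx.1 hx.2 ht).le
  rw [abs_mul, abs_of_nonneg (Real.rpow_nonneg hx.1.le _), mul_comm] at hlog
  rw [norm_mul, Complex.norm_cpow_eq_rpow_re_of_pos hx.1, Complex.norm_real, Real.norm_eq_abs,
    Complex.sub_re, Complex.one_re, hsplit, mul_assoc]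
  exact mul_le_mul_of_nonneg_left hlog (Real.rpow_nonneg hx.1.le _)

end LogMoment

section Taylor

variable {φ r : ℝ → ℝ} {m : ℕ} {C h : ℝ} {z : ℂ}

/-- The coefficient of `y ^ j` in the Taylor expansion of `φ` at `0`. -/
noncomputable def taylorCoeff (φ : ℝ → ℝ) (j : ℕ) : ℝ := iteratedDeriv j φ 0 / j.factorial

/-- The function `φ` minus its Taylor polynomial at `0` with `m` terms, which has degree `< m`. -/
noncomputable def taylorRemainder (φ : ℝ → ℝ) (m : ℕ) (y : ℝ) : ℝ :=
  φ y - ∑ j ∈ Finset.range m, taylorCoeff φ j * y ^ j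

theorem taylorRemainder_zero (φ : ℝ → ℝ) : taylorRemainder φ 0 = φ := by
  ext y
  simp [taylorRemainder]

theorem continuous_taylorRemainder (hφ : Continuous φ) (m : ℕ) :
    Continuous (taylorRemainder φ m) :=
  hφ.sub (by fun_prop)

theorem exists_abs_taylorRemainder_le (hφ : ContDiff ℝ m φ) {b : ℝ} (hb : 0 < b) :
    ∃ C, ∀ y ∈ Icc 0 b, |taylorRemainder φ m y| ≤ C * y ^ m := by
  cases m with
  | zero =>
    simpa [taylorRemainder_zero] using
      isCompact_Icc.exists_bound_of_continuousOn (f := φ) hφ.continuous.continuousOn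
  | succ m =>
    obtain ⟨C, hC⟩ := exists_taylor_mean_remainder_bound (n := m) hb.le
      (by exact_mod_cast hφ.contDiffOn)
    refine ⟨C, fun y hy => ?_⟩
    have hbound := hC y hy
    rw [sub_zero, taylor_within_apply, Real.norm_eq_abs] at hbound
    convert hbound using 3
    rw [taylorRemainder]
    congr 1
    refine Finset.sum_congr rfl fun j hj => ?_
    rw [iteratedDerivWithin_eq_iteratedDeriv (uniqueDiffOn_Icc hb)
      (hφ.contDiffAt.of_le (by exact_mod_cast (Finset.mem_range.mp hj).le)) ⟨le_rfl, hb.le⟩,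
      taylorCoeff, smul_eq_mul, sub_zero]
    ring

theorem ofReal_cpow_add_sub_one {x : ℝ} (hx : 0 < x) (z : ℂ) (j : ℕ) :
    (x : ℂ) ^ (1 - z + j - 1) = (x : ℂ) ^ (-z) * (x : ℂ) ^ j := by
  rw [← Complex.cpow_natCast, ← Complex.cpow_add _ _ (Complex.ofReal_ne_zero.mpr hx.ne')]
  ring_nf

theorem logIntegrand_eq_sum_add_taylorRemainder (φ : ℝ → ℝ) (m : ℕ) (z : ℂ) (h : ℝ) {x : ℝ}
    (hx : 0 < x) :
    logIntegrand φ z h x =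
      ∑ j ∈ Finset.range m,
        -(taylorCoeff φ j * h ^ j : ℂ) * ((x : ℂ) ^ (1 - z + j - 1) * (Real.log x : ℂ)) +
      logIntegrand (taylorRemainder φ m) z h x := by
  simp only [logIntegrand, taylorRemainder, ofReal_cpow_add_sub_one hx]
  push_cast
  rw [mul_sub, Finset.mul_sum, ← add_sub_assoc, add_sub_right_comm, ← Finset.sum_sub_distrib,
    Finset.sum_eq_zero fun j _ => by rw [mul_pow]; ring, zero_add]

theorem norm_logIntegrand_le_of_abs_le (z : ℂ) {x : ℝ} (hx : 0 < x)
    (hr : |r (x * h)| ≤ C * (x * h) ^ m) :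
    ‖logIntegrand r z h x‖ ≤ C * h ^ m * ‖(x : ℂ) ^ (1 - z + m - 1) * (Real.log x : ℂ)‖ := by
  have hnorm : ‖(x : ℂ) ^ (1 - z + m - 1)‖ = ‖(x : ℂ) ^ (-z)‖ * x ^ m := by
    rw [ofReal_cpow_add_sub_one hx, norm_mul, norm_pow, Complex.norm_real,
      Real.norm_of_nonneg hx.le]
  calc ‖logIntegrand r z h x‖
      = ‖(x : ℂ) ^ (-z)‖ * ‖(Real.log x : ℂ)‖ * |r (x * h)| := by
        rw [logIntegrand, norm_mul, norm_neg, norm_mul, Complex.norm_real (r _), Real.norm_eq_abs]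
    _ ≤ ‖(x : ℂ) ^ (-z)‖ * ‖(Real.log x : ℂ)‖ * (C * (x * h) ^ m) := by gcongr
    _ = C * h ^ m * ‖(x : ℂ) ^ (1 - z + m - 1) * (Real.log x : ℂ)‖ := by
        rw [norm_mul, hnorm, mul_pow]
        ring

theorem integrableOn_Ioc_logIntegrand_of_abs_le (hrc : Continuous r) (hz : z.re < m + 1)
    (hh : 0 < h) (hr : ∀ y ∈ Icc 0 h, |r y| ≤ C * y ^ m) :
    IntegrableOn (logIntegrand r z h) (Ioc 0 1) := by
  have hs : 0 < (1 - z + m : ℂ).re := by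
    simp only [Complex.add_re, Complex.sub_re, Complex.one_re, Complex.natCast_re]
    linarith
  refine Integrable.mono' ((integrableOn_Ioc_cpow_mul_log hs).norm.const_mul (C * h ^ m))
    (((continuousOn_logIntegrand hrc z h).mono Ioc_subset_Ioi_self).aestronglyMeasurable
      measurableSet_Ioc) ?_
  filter_upwards [ae_restrict_mem measurableSet_Ioc] with x hx
  exact norm_logIntegrand_le_of_abs_le z hx.1
    (hr _ ⟨mul_nonneg hx.1.le hh.le, mul_le_of_le_one_left hh.le hx.2⟩)

theorem tendsto_integral_Ioc_logIntegrand_of_abs_le (hm : m ≠ 0) (hz : z.re < m + 1)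
    (hr : ∀ y ∈ Icc 0 1, |r y| ≤ C * y ^ m) :
    Tendsto (fun h => ∫ x in Ioc (0 : ℝ) 1, logIntegrand r z h x) (𝓝[>] 0) (𝓝 0) := by
  have hs : 0 < (1 - z + m : ℂ).re := by
    simp only [Complex.add_re, Complex.sub_re, Complex.one_re, Complex.natCast_re]
    linarith
  set I := ∫ x in Ioc (0 : ℝ) 1, ‖(x : ℂ) ^ (1 - z + m - 1) * (Real.log x : ℂ)‖
  have hcont : Continuous fun h : ℝ => C * h ^ m * I := by fun_prop
  have hlim : Tendsto (fun h : ℝ => C * h ^ m * I) (𝓝[>] 0) (𝓝 0) := by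
    simpa [hm] using (hcont.tendsto 0).mono_left (nhdsWithin_le_nhds (s := Ioi 0))
  refine squeeze_zero_norm' ?_ hlim
  filter_upwards [Ioo_mem_nhdsGT one_pos] with h hh
  rw [← integral_const_mul]
  refine norm_integral_le_of_norm_le ((integrableOn_Ioc_cpow_mul_log hs).norm.const_mul _) ?_
  filter_upwards [ae_restrict_mem measurableSet_Ioc] with x hx
  exact norm_logIntegrand_le_of_abs_le z hx.1
    (hr _ ⟨mul_nonneg hx.1.le hh.1.le, mul_le_one₀ hx.2 hh.1.le hh.2.le⟩)

/-- The finite part of the integral of `logIntegrand φ z h` over `(0, 1]`, computed by expanding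
`φ` at `0` to `m` terms. -/
noncomputable def headFinitePart (φ : ℝ → ℝ) (m : ℕ) (z : ℂ) (h : ℝ) : ℂ :=
  ∑ j ∈ Finset.range m, -(taylorCoeff φ j * h ^ j : ℂ) * logMoment (1 - z + j) +
    ∫ x in Ioc (0 : ℝ) 1, logIntegrand (taylorRemainder φ m) z h x

theorem hasFinitePart_indicator_logIntegrand (hφ : ContDiff ℝ m φ) (hz : z.re < m + 1)
    (hh : 0 < h) :
    HasFinitePart ((Ioc 0 1).indicator (logIntegrand φ z h)) (headFinitePart φ m z h) := by
  obtain ⟨C, hC⟩ := exists_abs_taylorRemainder_le hφ hh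
  have hpoly := HasFinitePart.sum (s := Finset.range m) fun j _ =>
    (hasFinitePart_indicator_cpow_mul_log (1 - z + j)).const_mul (-(taylorCoeff φ j * h ^ j : ℂ))
  have hrem := hasFinitePart_indicator_of_integrableOn measurableSet_Ioc Ioc_subset_Ioi_self
    (integrableOn_Ioc_logIntegrand_of_abs_le (continuous_taylorRemainder hφ.continuous m) hz hh hC)
  refine (hpoly.add hrem).congr fun x hx => ?_
  by_cases hx1 : x ∈ Ioc (0 : ℝ) 1
  · simp only [indicator_of_mem hx1, logIntegrand_eq_sum_add_taylorRemainder φ m z h hx]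
  · simp [indicator_of_notMem hx1]

theorem hasFinitePart_logIntegrand (hφ : ContDiff ℝ m φ) (hs : HasCompactSupport φ)
    (hz : z.re < m + 1) (hh : 0 < h) :
    HasFinitePart (logIntegrand φ z h)
      (headFinitePart φ m z h + ∫ x in Ioi (1 : ℝ), logIntegrand φ z h x) :=
  (hasFinitePart_indicator_logIntegrand hφ hz hh).add_integral_Ioi_one
    (integrableOn_logIntegrand_Ioi hφ.continuous hs hh z one_pos)

theorem tendsto_headFinitePart (hm : m ≠ 0) (hφ : ContDiff ℝ m φ) (hz : z.re < m + 1) :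
    Tendsto (headFinitePart φ m z) (𝓝[>] 0) (𝓝 (φ 0 * (1 / (z - 1) ^ 2))) := by
  obtain ⟨C, hC⟩ := exists_abs_taylorRemainder_le hφ one_pos
  have hcont : Continuous fun h : ℝ => ∑ j ∈ Finset.range m,
      -(taylorCoeff φ j * h ^ j : ℂ) * logMoment (1 - z + j) := by fun_prop
  have hconst : ∑ j ∈ Finset.range m,
      -(taylorCoeff φ j * ((0 : ℝ) : ℂ) ^ j : ℂ) * logMoment (1 - z + j) =
        φ 0 * (1 / (z - 1) ^ 2) := by
    rw [Finset.sum_eq_single_of_mem 0 (Finset.mem_range.mpr (Nat.pos_of_ne_zero hm))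
      fun j _ hj => by simp [hj], logMoment, sub_sq_comm z 1]
    simp [taylorCoeff, neg_div]
  have hpoly := (hcont.tendsto 0).mono_left (nhdsWithin_le_nhds (s := Ioi 0))
  rw [hconst] at hpoly
  rw [← add_zero (_ * _)]
  exact hpoly.add (tendsto_integral_Ioc_logIntegrand_of_abs_le hm hz hC)

end Taylor

section DifferentialZeta

variable {φ : ℝ → ℝ} {m : ℕ} {p : ℕ∞} {h : ℝ} {z : ℂ}

theorem integrableOn_logIntegrand_Ioi_zero (hφ : Continuous φ) (hs : HasCompactSupport φ)
    (hh : 0 < h) (hz : z.re < 1) : IntegrableOn (logIntegrand φ z h) (Ioi 0) := by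
  obtain ⟨C, hC⟩ := hs.exists_bound_of_continuous hφ
  have hhead : IntegrableOn (logIntegrand φ z h) (Ioc 0 1) :=
    integrableOn_Ioc_logIntegrand_of_abs_le (m := 0) (C := C) hφ (by simpa using hz) hh
      fun y _ => by simpa using hC y
  rw [← Ioc_union_Ioi_eq_Ioi zero_le_one]
  exact hhead.union (integrableOn_logIntegrand_Ioi hφ hs hh z one_pos)

theorem tendsto_logSum_sub_finitePart (hφ : ContDiff ℝ m φ) (hs : HasCompactSupport φ)
    (hz : |z.re - 1| < m) (hz1 : z ≠ 1) :
    Tendsto (fun h => logSum φ z h - finitePart (logIntegrand φ z h)) (𝓝[>] 0)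
      (𝓝 (φ 0 * deriv riemannZeta z)) := by
  have hm : m ≠ 0 := by
    rintro rfl
    exact (abs_nonneg _).not_gt (by simpa using hz)
  obtain ⟨hlow, hupp⟩ := abs_lt.mp hz
  have hupp' : z.re < m + 1 := by linarith
  have hlim := (tendsto_logSum_sub_integral_Ioi_one hm hφ hs (by linarith) hz1).sub
    (tendsto_headFinitePart hm hφ hupp')
  rw [← mul_sub, add_sub_cancel_right] at hlim
  refine hlim.congr' ?_
  filter_upwards [self_mem_nhdsWithin] with h hh
  rw [(hasFinitePart_logIntegrand hφ hs hupp' hh).finitePart_eq]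
  ring

theorem finitePart_logIntegrand_eq_integral (hφ : Continuous φ) (hs : HasCompactSupport φ)
    (hh : 0 < h) (hz : z.re < 1) :
    finitePart (logIntegrand φ z h) = ∫ x in Ioi (0 : ℝ), logIntegrand φ z h x :=
  (hasFinitePart_of_integrableOn (integrableOn_logIntegrand_Ioi_zero hφ hs hh hz)).finitePart_eq

theorem tendsto_logSum_sub_integral (hφ : ContDiff ℝ m φ) (hs : HasCompactSupport φ)
    (hz : |z.re - 1| < m) (hz1 : z.re < 1) :
    Tendsto (fun h => logSum φ z h - ∫ x in Ioi (0 : ℝ), logIntegrand φ z h x) (𝓝[>] 0)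
      (𝓝 (φ 0 * deriv riemannZeta z)) := by
  refine (tendsto_logSum_sub_finitePart hφ hs hz (ne_of_apply_ne _ hz1.ne)).congr' ?_
  filter_upwards [self_mem_nhdsWithin] with h hh
  rw [finitePart_logIntegrand_eq_integral hφ.continuous hs hh hz1]

theorem exists_natCast_le_of_ofReal_lt {t : ℝ} (ht : ENNReal.ofReal t < (p : ENNReal)) :
    ∃ m : ℕ, (m : ℕ∞) ≤ p ∧ t < m := by
  induction p using ENat.recTopCoe with
  | top => exact (exists_nat_gt t).imp fun m hm => ⟨le_top, hm⟩
  | coe n =>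
    rw [ENat.toENNReal_coe] at ht
    have hn : n ≠ 0 := by
      rintro rfl
      simp at ht
    exact ⟨n, le_rfl, (ENNReal.ofReal_lt_natCast hn).mp ht⟩

end DifferentialZeta

section LinearSystem

open Matrix

variable {n 𝕜 : Type*} [Fintype n] [DecidableEq n]

theorem mulVec_eq_iff_eq_inv_mulVec [CommRing 𝕜] {A : Matrix n n 𝕜} (hA : IsUnit A.det)
    {v b : n → 𝕜} : A *ᵥ v = b ↔ v = A⁻¹ *ᵥ b := by
  constructor
  · rintro rfl
    rw [mulVec_mulVec, nonsing_inv_mul _ hA, one_mulVec]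
  · rintro rfl
    rw [mulVec_mulVec, mul_nonsing_inv _ hA, one_mulVec]

variable [Field 𝕜] [TopologicalSpace 𝕜] {ι : Type*} {l : Filter ι} {A : ι → Matrix n n 𝕜}
  {A₀ : Matrix n n 𝕜}

theorem eventually_isUnit_det [IsTopologicalRing 𝕜] [T1Space 𝕜] (hA : Tendsto A l (𝓝 A₀))
    (hA₀ : IsUnit A₀.det) : ∀ᶠ i in l, IsUnit (A i).det := by
  have hdet := ((continuous_id.matrix_det).tendsto A₀).comp hA
  exact (hdet.eventually_ne hA₀.ne_zero).mono fun i hi => isUnit_iff_ne_zero.mpr hi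

theorem eventually_existsUnique_mulVec_eq [IsTopologicalRing 𝕜] [T1Space 𝕜]
    (hA : Tendsto A l (𝓝 A₀)) (hA₀ : IsUnit A₀.det) (b : ι → n → 𝕜) :
    ∀ᶠ i in l, ∃! v, A i *ᵥ v = b i := by
  filter_upwards [eventually_isUnit_det hA hA₀] with i hi
  simp only [mulVec_eq_iff_eq_inv_mulVec hi, existsUnique_eq]

theorem tendsto_of_eventually_mulVec_eq [IsTopologicalDivisionRing 𝕜] [T1Space 𝕜]
    (hA : Tendsto A l (𝓝 A₀)) (hA₀ : IsUnit A₀.det) {b v : ι → n → 𝕜} {b₀ : n → 𝕜}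
    (hb : Tendsto b l (𝓝 b₀)) (hv : ∀ᶠ i in l, A i *ᵥ v i = b i) :
    Tendsto v l (𝓝 (A₀⁻¹ *ᵥ b₀)) := by
  have hinv : Tendsto (fun i => (A i)⁻¹) l (𝓝 A₀⁻¹) := by
    refine (continuousAt_matrix_inv A₀ ?_).tendsto.comp hA
    simpa only [Ring.inverse_eq_inv'] using continuousAt_inv₀ hA₀.ne_zero
  have hmul : Continuous fun q : Matrix n n 𝕜 × (n → 𝕜) => q.1 *ᵥ q.2 :=
    continuous_fst.matrix_mulVec continuous_snd
  refine ((hmul.tendsto (A₀⁻¹, b₀)).comp (hinv.prodMk_nhds hb)).congr' ?_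
  filter_upwards [eventually_isUnit_det hA hA₀, hv] with i hi hvi
  exact ((mulVec_eq_iff_eq_inv_mulVec hi).mp hvi).symm

end LinearSystem

section MomentSystem

open Matrix

variable {η : ℝ → ℝ} {k m : ℕ} {h : ℝ}

/-- The matrix of the moment-fitting equations. -/
noncomputable def momentMatrix (η : ℝ → ℝ) (K : ℕ) (h : ℝ) :
    Matrix (Fin (K + 1)) (Fin (K + 1)) ℝ :=
  .of fun k j => (j : ℝ) ^ (2 * (k : ℕ)) * η (j * h)

/-- The right-hand side of the `k`-th moment-fitting equation. -/
noncomputable def momentDefect (η : ℝ → ℝ) (h : ℝ) (k : ℕ) : ℝ :=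
  (∫ x in Ioi (0 : ℝ), -(x ^ (2 * k) * Real.log x) * η (x * h)) -
    ∑' n : ℕ, -(((n : ℝ) + 1) ^ (2 * k) * Real.log ((n : ℝ) + 1)) * η (((n : ℝ) + 1) * h)

theorem solvesLogMomentSystem_iff (η : ℝ → ℝ) (K : ℕ) (h : ℝ) (w : Fin (K + 1) → ℝ) :
    SolvesLogMomentSystem η K h w ↔
      momentMatrix η K h *ᵥ w = fun k : Fin (K + 1) => momentDefect η h k := by
  rw [funext_iff]
  simp only [SolvesLogMomentSystem, mulVec, dotProduct, momentMatrix, momentDefect, of_apply,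
    mul_comm (w _), mul_right_comm _ (w _)]

theorem continuous_momentMatrix (hη : Continuous η) (K : ℕ) : Continuous (momentMatrix η K) := by
  refine continuous_matrix fun k j => ?_
  simp only [momentMatrix, of_apply]
  fun_prop

theorem momentMatrix_zero (h0 : η 0 = 1) (K : ℕ) :
    momentMatrix η K 0 = (vandermonde fun j : Fin (K + 1) => (j : ℝ) ^ 2)ᵀ := by
  ext k j
  simp [momentMatrix, h0, vandermonde_apply, pow_mul]

theorem isUnit_det_momentMatrix_zero (h0 : η 0 = 1) (K : ℕ) :
    IsUnit (momentMatrix η K 0).det := by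
  rw [momentMatrix_zero h0, det_transpose, isUnit_iff_ne_zero, det_vandermonde_ne_zero_iff]
  intro i j hij
  exact Fin.ext (Nat.cast_injective
    ((pow_left_inj₀ (Nat.cast_nonneg _) (Nat.cast_nonneg _) two_ne_zero).mp hij))

theorem logIntegrand_neg_two_mul (η : ℝ → ℝ) (k : ℕ) (h x : ℝ) :
    logIntegrand η (-2 * k) h x = ((-(x ^ (2 * k) * Real.log x) * η (x * h) : ℝ) : ℂ) := by
  have hexp : -(-2 * k : ℂ) = (2 * k : ℕ) := by
    push_cast
    ring
  rw [logIntegrand, hexp, Complex.cpow_natCast]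
  push_cast
  rfl

theorem ofReal_momentDefect (η : ℝ → ℝ) (h : ℝ) (k : ℕ) :
    (momentDefect η h k : ℂ) =
      -(logSum η (-2 * k) h - ∫ x in Ioi (0 : ℝ), logIntegrand η (-2 * k) h x) := by
  simp only [logSum, logIntegrand_neg_two_mul]
  rw [integral_complex_ofReal, ← Complex.ofReal_tsum, momentDefect, neg_sub, Complex.ofReal_sub]

theorem tendsto_ofReal_momentDefect (hη : ContDiff ℝ m η) (hs : HasCompactSupport η)
    (h0 : η 0 = 1) (hk : 2 * k + 1 < m) :
    Tendsto (fun h => (momentDefect η h k : ℂ)) (𝓝[>] 0) (𝓝 (-deriv riemannZeta (-2 * k))) := by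
  have hre : (-2 * k : ℂ).re = -(2 * k : ℝ) := by simp
  have hk0 : (0 : ℝ) ≤ 2 * k := by positivity
  have habs : |(-2 * k : ℂ).re - 1| < m := by
    rw [hre, abs_of_nonpos (by linarith [hk0])]
    have hkm : (2 * k + 1 : ℝ) < m := by exact_mod_cast hk
    linarith
  simpa only [ofReal_momentDefect, h0, Complex.ofReal_one, one_mul] using
    (tendsto_logSum_sub_integral hη hs habs (by rw [hre]; linarith [hk0])).neg

theorem exists_tendsto_momentDefect (hη : ContDiff ℝ m η) (hs : HasCompactSupport η)
    (h0 : η 0 = 1) (hk : 2 * k + 1 < m) :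
    ∃ β : ℝ, (β : ℂ) = -deriv riemannZeta (-2 * k) ∧
      Tendsto (fun h => momentDefect η h k) (𝓝[>] 0) (𝓝 β) := by
  have hlim := tendsto_ofReal_momentDefect hη hs h0 hk
  have hre := (Complex.continuous_re.tendsto _).comp hlim
  exact ⟨_, tendsto_nhds_unique ((Complex.continuous_ofReal.tendsto _).comp hre) hlim, hre⟩

theorem solvesZetaPrimeSystem_iff (h0 : η 0 = 1) {K : ℕ} {β : Fin (K + 1) → ℝ}
    (hβ : ∀ k : Fin (K + 1), (β k : ℂ) = -deriv riemannZeta (-2 * (k : ℕ)))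
    (v : Fin (K + 1) → ℝ) :
    SolvesZetaPrimeSystem K v ↔ momentMatrix η K 0 *ᵥ v = β := by
  rw [funext_iff]
  refine forall_congr' fun k => ?_
  rw [← hβ, ← Complex.ofReal_inj]
  simp [mulVec, dotProduct, momentMatrix, h0, mul_comm]

theorem exists_tendsto_of_solvesLogMomentSystem (hη : ContDiff ℝ m η) (hs : HasCompactSupport η)
    (h0 : η 0 = 1) {K : ℕ} (hK : 2 * K + 1 < m) :
    (∀ᶠ h in 𝓝[>] (0 : ℝ), ∃! v, SolvesLogMomentSystem η K h v) ∧
      ∃ w : Fin (K + 1) → ℝ,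
        (∀ W : ℝ → Fin (K + 1) → ℝ, (∀ᶠ h in 𝓝[>] (0 : ℝ), SolvesLogMomentSystem η K h (W h)) →
          Tendsto W (𝓝[>] 0) (𝓝 w)) ∧
        ∀ v, SolvesZetaPrimeSystem K v ↔ v = w := by
  have hM : Tendsto (momentMatrix η K) (𝓝[>] 0) (𝓝 (momentMatrix η K 0)) :=
    ((continuous_momentMatrix hη.continuous K).tendsto 0).mono_left nhdsWithin_le_nhds
  have hdet := isUnit_det_momentMatrix_zero h0 K
  choose β hβ hlim using fun k : Fin (K + 1) =>
    exists_tendsto_momentDefect (k := k) hη hs h0 (by omega)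
  simp only [solvesLogMomentSystem_iff, solvesZetaPrimeSystem_iff h0 hβ,
    mulVec_eq_iff_eq_inv_mulVec hdet]
  exact ⟨eventually_existsUnique_mulVec_eq hM hdet _, _,
    fun W hW => tendsto_of_eventually_mulVec_eq hM hdet (tendsto_pi_nhds.mpr hlim) hW,
    fun v => Iff.rfl⟩

end MomentSystem

theorem mainTheorem1_general (p : ℕ∞) (η : ℝ → ℝ) (hη : ContDiff ℝ p η)
    (hs : HasCompactSupport η) (h0 : η 0 = 1) :
    (∀ z : ℂ, z ≠ 1 → ENNReal.ofReal |z.re - 1| < (p : ENNReal) →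
      (∀ h : ℝ, 0 < h → ∃ L : ℂ, HasFinitePart (logIntegrand η z h) L) ∧
      Tendsto (fun h : ℝ => logSum η z h - finitePart (logIntegrand η z h))
        (𝓝[>] 0) (𝓝 (deriv riemannZeta z)) ∧
      (z.re < 1 →
        (∀ h : ℝ, 0 < h → IntegrableOn (logIntegrand η z h) (Ioi 0)) ∧
        Tendsto (fun h : ℝ => logSum η z h - ∫ x in Ioi (0 : ℝ), logIntegrand η z h x)
          (𝓝[>] 0) (𝓝 (deriv riemannZeta z)))) ∧
    (∀ K : ℕ, ((2 * K + 1 : ℕ) : ℕ∞) < p →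
      (∀ᶠ h in 𝓝[>] (0 : ℝ), ∃! v : Fin (K + 1) → ℝ, SolvesLogMomentSystem η K h v) ∧
      ∃ w : Fin (K + 1) → ℝ,
        (∀ W : ℝ → Fin (K + 1) → ℝ,
          (∀ᶠ h in 𝓝[>] (0 : ℝ), SolvesLogMomentSystem η K h (W h)) →
            ∀ j, Tendsto (fun h => W h j) (𝓝[>] 0) (𝓝 (w j))) ∧
        ∀ v : Fin (K + 1) → ℝ, SolvesZetaPrimeSystem K v ↔ v = w) := by
  constructor
  · intro z hz1 hzp
    obtain ⟨m, hmp, hzm⟩ := exists_natCast_le_of_ofReal_lt hzp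
    have hηm : ContDiff ℝ m η := hη.of_le (by exact_mod_cast hmp)
    have hzm' : z.re < m + 1 := by linarith [(abs_lt.mp hzm).2]
    refine ⟨fun h hh => ⟨_, hasFinitePart_logIntegrand hηm hs hzm' hh⟩, ?_, fun hre =>
      ⟨fun h hh => integrableOn_logIntegrand_Ioi_zero hη.continuous hs hh hre, ?_⟩⟩
    · simpa [h0] using tendsto_logSum_sub_finitePart hηm hs hzm hz1
    · simpa [h0] using tendsto_logSum_sub_integral hηm hs hzm hre
  · intro K hK
    obtain ⟨m, hmp, hKm⟩ : ∃ m : ℕ, (m : ℕ∞) ≤ p ∧ 2 * K + 1 < m :=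
      ⟨2 * K + 1 + 1, Order.add_one_le_of_lt hK, Nat.lt_succ_self _⟩
    have hηm : ContDiff ℝ m η := hη.of_le (by exact_mod_cast hmp)
    simpa only [tendsto_pi_nhds] using exists_tendsto_of_solvesLogMomentSystem hηm hs h0 hKm

theorem mainTheorem1 (p : ℕ∞) (η : ℝ → ℝ) (hη : IsCutoff p η) :
    (∀ z : ℂ, z ≠ 1 → ENNReal.ofReal |z.re - 1| < (p : ENNReal) →
      (∀ h : ℝ, 0 < h → ∃ L : ℂ, HasFinitePart (logIntegrand η z h) L) ∧
      Tendsto (fun h : ℝ => logSum η z h - finitePart (logIntegrand η z h))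
        (𝓝[>] 0) (𝓝 (deriv riemannZeta z)) ∧
      (z.re < 1 →
        (∀ h : ℝ, 0 < h → IntegrableOn (logIntegrand η z h) (Ioi 0)) ∧
        Tendsto (fun h : ℝ => logSum η z h - ∫ x in Ioi (0 : ℝ), logIntegrand η z h x)
          (𝓝[>] 0) (𝓝 (deriv riemannZeta z)))) ∧
    (∀ K : ℕ, ((2 * K + 1 : ℕ) : ℕ∞) < p →
      (∀ᶠ h in 𝓝[>] (0 : ℝ), ∃! v : Fin (K + 1) → ℝ, SolvesLogMomentSystem η K h v) ∧
      ∃ w : Fin (K + 1) → ℝ,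
        (∀ W : ℝ → Fin (K + 1) → ℝ,
          (∀ᶠ h in 𝓝[>] (0 : ℝ), SolvesLogMomentSystem η K h (W h)) →
            ∀ j, Tendsto (fun h => W h j) (𝓝[>] 0) (𝓝 (w j))) ∧
        ∀ v : Fin (K + 1) → ℝ, SolvesZetaPrimeSystem K v ↔ v = w) :=
  mainTheorem1_general p η hη.contDiff hη.hasCompactSupport hη.map_zero
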